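/- **Setting.** Let $\Omega=(0,1)^2$, let $\kappa$ be a measurable piecewise constant (finitely many values) function with $\min_\Omega\kappa=1$ and $\max_\Omega\kappa=\beta$, let $f\in L^2(\Omega)$, $a(u,v)=\int_\Omega\kappa\nabla u\cdot\nabla v\,dx$ and $\|v\|_a=\sqrt{a(v,v)}$. Let $\mathcal T_H$ be the uniform mesh of $\Omega$ by closed squares $K_1,\dots,K_m$ of side $H=1/N$, and $\mathcal T_h$ its uniform refinement into squares of side $h=H/r$ ($N,r\ge1$ integers). Let $V_h\subset H^1_0(\Omega)$ be the $Q_1$ finite element space of $\mathcal T_h$, let $V_h(K_i)$ be the restriction of $V_h$ to $K_i$, $n_i=\dim V_h(K_i)$, $a_i(v,w)=\int_{K_i}\kappa\nabla v\cdot\nabla w\,dx$ and $s_i(v,w)=H^{-2}\int_{K_i}\kappa vw\,dx$. *Auxiliary space.* Let $\psi^{(i)}_1,\dots,\psi^{(i)}_{n_i}\in V_h(K_i)$ be $s_i$-orthonormal with $a_i(\psi^{(i)}_j,w)=\lambda^{(i)}_j s_i(\psi^{(i)}_j,w)$ for all $w\in V_h(K_i)$ and $\lambda^{(i)}_1\le\dots\le\lambda^{(i)}_{n_i}$.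 Let $0\le L_i\le n_i$ be such that $\lambda^{(i)}_j>\mu_i/2$ for $j>L_i$, where $\mu_i$ is the first nonzero eigenvalue of the same problem with $\kappa=1$. Put $V_{aux}=\bigoplus_i\mathrm{span}\{\psi^{(i)}_1,\dots,\psi^{(i)}_{L_i}\}$, $L=\dim V_{aux}=\sum_iL_i$, $\Pi^{(i)}_{aux}v=\sum_{j\le L_i}s_i(v,\psi^{(i)}_j)\psi^{(i)}_j$ and $\mathrm{Ker}\,\Pi_{aux}=\{v\in V_h:\Pi^{(i)}_{aux}(v|_{K_i})=0\ \forall i\}$. *Dual nodes.* Assume that $\hat p^{(i)}_1,\dots,\hat p^{(i)}_{L_i}$ are vertices of $\mathcal T_h$ in the interior of $K_i$ such that, with $\hat\phi^{(i)}_j$ the hat function at $\hat p^{(i)}_j$ normalized by $a_i(\hat\phi^{(i)}_j,\hat\phi^{(i)}_j)=1$, the matrix $S_i=\big(s_i(\hat\phi^{(i)}_j,\psi^{(i)}_l)\big)_{1\le j,l\le L_i}$ is nonsingular, and that no element of $\mathcal T_h$ has two of the dual nodes (for all $i,j$) as vertices. Let $\tilde\phi^{(i)}_j=\sum_l(S_i^{-1})_{jl}\hat\phi^{(i)}_l$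 be the dual functions, let $M_i$ be the 2-norm of the matrix $\big(a(\tilde\phi^{(i)}_j,\tilde\phi^{(i)}_l)\big)_{1\le j,l\le L_i}$, and $M=\max_iM_i$. *Kernel basis.* Let $\mathbf A$ be the stiffness matrix of $a(\cdot,\cdot)$ in the nodal basis of $V_h$; functions in $V_h$ are identified with their nodal vectors. For an interior vertex $p$ of $\mathcal T_h$ that is not a dual node let $\phi_p$ be the hat function at $p$ normalized by $\|\phi_p\|_a=1$ and $v_p=\phi_p-\sum_{i,j}s_i(\phi_p,\psi^{(i)}_j)\tilde\phi^{(i)}_j$. Assume that there is at least one such $p$. The columns of $\mathbf K$ are the following vectors, each group being taken in an arbitrary order: (i) for each $K_i$, the result of the modified Gram–Schmidt algorithm (in the $\mathbf A$-inner product) applied to the $v_p$ with $p$ interior to $K_i$; (ii) for each interior edge $E$ of $\mathcal T_H$, the result of the modified Gram–Schmidt algorithm applied to the $v_p$ with $p$ interior to $E$, after subtracting their $\mathbf A$-orthogonal projections onto the span of the vectors (i) of the two elements sharing $E$; (iii) for each interior vertex $p$ of $\mathcal T_H$, the $\mathbf A$-normalization of $v_p$ minus its $\mathbf A$-orthogonal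 projection onto the span of the vectors (i) and (ii) of the four elements and four edges that meet at $p$. Let $\mathfrak K=\lambda_{\max}(\mathbf K^T\mathbf A\mathbf K)/\lambda_{\min}(\mathbf K^T\mathbf A\mathbf K)$ and $q=(\sqrt{\mathfrak K}-1)/(\sqrt{\mathfrak K}+1)$. *Methods.* Let $V^{ms,h}_{aux}=\{v\in V_h:a(v,w)=0\ \forall w\in\mathrm{Ker}\,\Pi_{aux}\}$. For $k\ge0$ let $\hat{\mathbf x}^{(i)}_j$ be the $k$-th conjugate gradient iterate with initial guess $\mathbf 0$ for $\mathbf K^T\mathbf A\mathbf K\,\mathbf x=\mathbf K^T\mathbf A\,\mathbf f^{(i)}_j$, where $\mathbf f^{(i)}_j$ is the nodal vector of $\hat\phi^{(i)}_j$; let $\mathfrak C_{h,k}\hat\phi^{(i)}_j$ be the function with nodal vector $\mathbf K\hat{\mathbf x}^{(i)}_j$, and $V^{ms,h}_{aux,k}=\mathrm{span}\{\hat\phi^{(i)}_j-\mathfrak C_{h,k}\hat\phi^{(i)}_j:1\le i\le m,\ 1\le j\le L_i\}$. Let $u_h\in V_h$, $u^{ms,h}_{aux}\in V^{ms,h}_{aux}$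 and $u^{ms,h}_{aux,k}\in V^{ms,h}_{aux,k}$ be the Galerkin solutions of $a(u,v)=\int_\Omega fv\,dx$ in these spaces. **Theorem.** For every $k\ge0$, $$\|u_h-u^{ms,h}_{aux,k}\|_a\le\|u_h-u^{ms,h}_{aux}\|_a+\frac{2q^k}{1+q^{2k}}\,\sqrt L\,\sqrt M\,H^{-1}\sqrt\beta\,\|f\|_{L^2(\Omega)}.$$ -/

import Mathlib

open MeasureTheory Matrix

noncomputable section

namespace SpectralLOD

/-! ### Meshes and the `Q₁` finite element space

`N` is the number of coarse elements per side, so `H = 1 / N`; each coarse element is split into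
`r × r` fine elements, so `h = 1 / (N r)`. -/

/-- The open unit square `Ω`. -/
def unitSq : Set (ℝ × ℝ) := Set.Ioo 0 1 ×ˢ Set.Ioo 0 1

/-- The coarse mesh size. -/
def meshH (N : ℕ) : ℝ := 1 / (N : ℝ)

/-- The fine mesh size. -/
def meshh (N r : ℕ) : ℝ := 1 / ((N : ℝ) * (r : ℝ))

/-- The closed square `[a s, (a+1) s] × [b s, (b+1) s]`. -/
def cell (s : ℝ) (a b : ℕ) : Set (ℝ × ℝ) :=
  Set.Icc (a * s) ((a + 1) * s) ×ˢ Set.Icc (b * s) ((b + 1) * s)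

/-- Indices of the coarse elements. -/
abbrev Coarse (N : ℕ) : Type := Fin N × Fin N

/-- The (closed) coarse element `K_i`. -/
def elem {N : ℕ} (i : Coarse N) : Set (ℝ × ℝ) := cell (meshH N) i.1 i.2

/-- The interior vertices of the fine mesh; `p` is the vertex `((p.1 + 1) h, (p.2 + 1) h)`. -/
abbrev Node (N r : ℕ) : Type := Fin (N * r - 1) × Fin (N * r - 1)

/-- The coordinates of an interior vertex of the fine mesh. -/
def coord {N r : ℕ} (p : Node N r) : ℝ × ℝ :=
  (((p.1 : ℕ) + 1 : ℝ) * meshh N r, ((p.2 : ℕ) + 1 : ℝ) * meshh N r)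

/-- The space `V_h`: continuous functions, bilinear on every fine element, vanishing on `∂Ω`
(and extended by zero outside `Ω`). -/
def Vh (N r : ℕ) : Submodule ℝ (ℝ × ℝ → ℝ) where
  carrier := {v | Continuous v ∧ (∀ x, x ∉ unitSq → v x = 0) ∧
    ∀ a b : ℕ, a < N * r → b < N * r → ∃ c₀ c₁ c₂ c₃ : ℝ, ∀ x ∈ cell (meshh N r) a b,
      v x = c₀ + c₁ * x.1 + c₂ * x.2 + c₃ * (x.1 * x.2)}
  add_mem' := by
    rintro u v ⟨hu, hu0, hub⟩ ⟨hv, hv0, hvb⟩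
    refine ⟨hu.add hv, fun x hx => by simp [hu0 x hx, hv0 x hx], fun a b ha hb => ?_⟩
    obtain ⟨c₀, c₁, c₂, c₃, hc⟩ := hub a b ha hb
    obtain ⟨d₀, d₁, d₂, d₃, hd⟩ := hvb a b ha hb
    refine ⟨c₀ + d₀, c₁ + d₁, c₂ + d₂, c₃ + d₃, fun x hx => ?_⟩
    rw [Pi.add_apply, hc x hx, hd x hx]
    ring
  zero_mem' := ⟨continuous_const, fun _ _ => rfl, fun _ _ _ _ => ⟨0, 0, 0, 0, by simp⟩⟩
  smul_mem' := by
    rintro t u ⟨hu, hu0, hub⟩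
    refine ⟨hu.const_smul t, fun x hx => by simp [hu0 x hx], fun a b ha hb => ?_⟩
    obtain ⟨c₀, c₁, c₂, c₃, hc⟩ := hub a b ha hb
    refine ⟨t * c₀, t * c₁, t * c₂, t * c₃, fun x hx => ?_⟩
    rw [Pi.smul_apply, hc x hx, smul_eq_mul]
    ring

/-- Restriction of functions to a set `S`, functions on `S` being represented by their
extension by zero. -/
def restr (S : Set (ℝ × ℝ)) : (ℝ × ℝ → ℝ) →ₗ[ℝ] (ℝ × ℝ → ℝ) where
  toFun v := S.indicator v
  map_add' u v := Set.indicator_add S u v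
  map_smul' t v := Set.indicator_const_smul S t v

/-- The local space `V_h(K_i)`: the restriction of `V_h` to `K_i`. -/
def VhLoc (N r : ℕ) (i : Coarse N) : Submodule ℝ (ℝ × ℝ → ℝ) := (Vh N r).map (restr (elem i))

/-- `n_i = dim V_h(K_i)`. -/
def dimLoc (N r : ℕ) (i : Coarse N) : ℕ := Module.finrank ℝ (VhLoc N r i)

/-- The nodal basis (hat) function of the vertex `p`. -/
def hat {N r : ℕ} (p : Node N r) (x : ℝ × ℝ) : ℝ :=
  max 0 (1 - |x.1 / meshh N r - ((p.1 : ℕ) + 1)|) *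
    max 0 (1 - |x.2 / meshh N r - ((p.2 : ℕ) + 1)|)

/-! ### Bilinear forms -/

def dx (u : ℝ × ℝ → ℝ) (x : ℝ × ℝ) : ℝ := deriv (fun t => u (t, x.2)) x.1

def dy (u : ℝ × ℝ → ℝ) (x : ℝ × ℝ) : ℝ := deriv (fun t => u (x.1, t)) x.2

/-- `∫_S κ ∇u · ∇v dx`. The classical partial derivatives of piecewise bilinear functions exist
off the grid lines, hence almost everywhere. -/
def energyOn (κ : ℝ × ℝ → ℝ) (S : Set (ℝ × ℝ)) (u v : ℝ × ℝ → ℝ) : ℝ :=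
  ∫ x in S, κ x * (dx u x * dx v x + dy u x * dy v x)

/-- The bilinear form `a(u, v) = ∫_Ω κ ∇u · ∇v dx`. -/
def energy (κ : ℝ × ℝ → ℝ) (u v : ℝ × ℝ → ℝ) : ℝ := energyOn κ unitSq u v

/-- The energy norm `‖v‖_a`. -/
def energyNorm (κ : ℝ × ℝ → ℝ) (v : ℝ × ℝ → ℝ) : ℝ := √(energy κ v v)

/-- The form `s_i(u, v) = H⁻² ∫_{K_i} κ u v dx`. -/
def massOn {N : ℕ} (κ : ℝ × ℝ → ℝ) (i : Coarse N) (u v : ℝ × ℝ → ℝ) : ℝ :=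
  (meshH N)⁻¹ ^ 2 * ∫ x in elem i, κ x * (u x * v x)

/-- `u` is the Galerkin solution for the trial and test space `V`. -/
def IsGalerkin (κ f : ℝ × ℝ → ℝ) (V : Set (ℝ × ℝ → ℝ)) (u : ℝ × ℝ → ℝ) : Prop :=
  u ∈ V ∧ ∀ v ∈ V, energy κ u v = ∫ x in unitSq, f x * v x

/-! ### The auxiliary space -/

/-- `μ_i`: the first nonzero eigenvalue of the local eigenvalue problem with `κ = 1`. -/
def muLoc (N r : ℕ) (i : Coarse N) : ℝ :=
  sInf {μ : ℝ | μ ≠ 0 ∧ ∃ ψ ∈ VhLoc N r i, ψ ≠ 0 ∧ ∀ w ∈ VhLoc N r i,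
    energyOn (fun _ => 1) (elem i) ψ w = μ * massOn (fun _ => 1) i ψ w}

/-- The choices made in the construction of the auxiliary space: on every coarse element a full
`s_i`-orthonormal system of eigenfunctions with nondecreasing eigenvalues, and the number `L_i` of
eigenfunctions that are kept. -/
structure AuxBasis (N r : ℕ) (κ : ℝ × ℝ → ℝ) where
  lam : ∀ i : Coarse N, Fin (dimLoc N r i) → ℝ
  psi : ∀ i : Coarse N, Fin (dimLoc N r i) → (ℝ × ℝ → ℝ)
  lam_mono : ∀ i, Monotone (lam i)
  psi_mem : ∀ i j, psi i j ∈ VhLoc N r i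
  eigen : ∀ i j, ∀ w ∈ VhLoc N r i,
    energyOn κ (elem i) (psi i j) w = lam i j * massOn κ i (psi i j) w
  orthonormal : ∀ i j l, massOn κ i (psi i j) (psi i l) = if j = l then 1 else 0
  L : Coarse N → ℕ
  L_le : ∀ i, L i ≤ dimLoc N r i
  choice : ∀ i (j : Fin (dimLoc N r i)), L i ≤ (j : ℕ) → muLoc N r i / 2 < lam i j

namespace AuxBasis

variable {N r : ℕ} {κ : ℝ × ℝ → ℝ} (X : AuxBasis N r κ)

/-- The eigenfunctions `ψ_j^{(i)}`, `j < L_i`, that span `V_aux^{(i)}`. -/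
def psiAux (i : Coarse N) (j : Fin (X.L i)) : ℝ × ℝ → ℝ := X.psi i (Fin.castLE (X.L_le i) j)

/-- `L = dim V_aux`. -/
def Ltot : ℕ := ∑ i, X.L i

/-- `Π_aux^{(i)} v = ∑_{j < L_i} s_i(v, ψ_j) ψ_j`. -/
def projLoc (i : Coarse N) (v : ℝ × ℝ → ℝ) : ℝ × ℝ → ℝ :=
  ∑ j, massOn κ i v (X.psiAux i j) • X.psiAux i j

/-- The kernel of `Π_aux` in `V_h`. -/
def kerProj : Set (ℝ × ℝ → ℝ) := {v | v ∈ Vh N r ∧ ∀ i, X.projLoc i (restr (elem i) v) = 0}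

/-- The ideal multiscale space. -/
def Vms : Set (ℝ × ℝ → ℝ) := {v | v ∈ Vh N r ∧ ∀ w ∈ X.kerProj, energy κ v w = 0}

end AuxBasis

/-- The hat function of a vertex interior to `K_i`, normalized by `a_i(φ, φ) = 1`. -/
def hatLoc {N r : ℕ} (κ : ℝ × ℝ → ℝ) (i : Coarse N) (p : Node N r) : ℝ × ℝ → ℝ :=
  (√(energyOn κ (elem i) (hat p) (hat p)))⁻¹ • hat p

/-- The hat function of `p`, normalized by `‖φ_p‖_a = 1`. -/
def hatNormalized {N r : ℕ} (κ : ℝ × ℝ → ℝ) (p : Node N r) : ℝ × ℝ → ℝ :=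
  (energyNorm κ (hat p))⁻¹ • hat p

/-- Dual nodes: `L_i` vertices of the fine mesh in the interior of each `K_i` for which the matrix
`S_i` is nonsingular, separated in the sense that no fine element has two of the dual nodes as
vertices. -/
structure DualNodes {N r : ℕ} {κ : ℝ × ℝ → ℝ} (X : AuxBasis N r κ) where
  node : ∀ i : Coarse N, Fin (X.L i) → Node N r
  mem_interior : ∀ i j, coord (node i j) ∈ interior (elem i)
  nonsingular : ∀ i, IsUnit (Matrix.of fun j l : Fin (X.L i) =>
    massOn κ i (hatLoc κ i (node i j)) (X.psiAux i l)).det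
  separated : ∀ s t : (Σ i : Coarse N, Fin (X.L i)), s ≠ t → ∀ a b : ℕ, a < N * r → b < N * r →
    ¬ (coord (node s.1 s.2) ∈ cell (meshh N r) a b ∧ coord (node t.1 t.2) ∈ cell (meshh N r) a b)

/-! ### Numerical linear algebra -/

/-- The modified Gram–Schmidt algorithm in the inner product given by `A`. -/
def mgs {ι : Type} [Fintype ι] (A : Matrix ι ι ℝ) : List (ι → ℝ) → List (ι → ℝ)
  | [] => []
  | v :: vs =>
    (√(v ⬝ᵥ (A *ᵥ v)))⁻¹ • v ::
      mgs A (vs.map fun u =>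
        u - (((√(v ⬝ᵥ (A *ᵥ v)))⁻¹ • v) ⬝ᵥ (A *ᵥ u)) • ((√(v ⬝ᵥ (A *ᵥ v)))⁻¹ • v))
  termination_by l => l.length

/-- Subtract from `v` its `A`-orthogonal projection onto the span of the (linearly independent)
list `W`. -/
def orthAgainst {ι : Type} [Fintype ι] (A : Matrix ι ι ℝ) (W : List (ι → ℝ)) (v : ι → ℝ) :
    ι → ℝ :=
  v - ((mgs A W).map fun w => (w ⬝ᵥ (A *ᵥ v)) • w).sum

/-- One conjugate gradient step on (iterate, residual, search direction). After the exact
solution has been reached, the residual and the direction are zero and, since `0 / 0 = 0`, the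
iterate no longer changes. -/
def cgStep {ι : Type} [Fintype ι] (B : Matrix ι ι ℝ) (s : (ι → ℝ) × (ι → ℝ) × (ι → ℝ)) :
    (ι → ℝ) × (ι → ℝ) × (ι → ℝ) :=
  let x := s.1
  let res := s.2.1
  let p := s.2.2
  let α := (res ⬝ᵥ res) / (p ⬝ᵥ (B *ᵥ p))
  let res' := res - α • (B *ᵥ p)
  let γ := (res' ⬝ᵥ res') / (res ⬝ᵥ res)
  (x + α • p, res', res' + γ • p)

/-- The `k`-th conjugate gradient iterate for `B x = b` with initial guess `0`. -/
def cg {ι : Type} [Fintype ι] (B : Matrix ι ι ℝ) (b : ι → ℝ) (k : ℕ) : ι → ℝ :=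
  ((cgStep B)^[k] (0, b, b)).1

/-- The condition number `λ_max / λ_min` of a symmetric positive definite matrix. -/
def condNumber {ι : Type} [Fintype ι] [DecidableEq ι] (B : Matrix ι ι ℝ) : ℝ :=
  sSup (spectrum ℝ B) / sInf (spectrum ℝ B)

/-- The vector representing `v ∈ V_h` in the nodal basis. -/
def coeffs {N r : ℕ} (v : ℝ × ℝ → ℝ) : Node N r → ℝ := fun p => v (coord p)

/-- The finite element function represented by a vector in the nodal basis. -/
def ofCoeffs {N r : ℕ} (c : Node N r → ℝ) : ℝ × ℝ → ℝ := ∑ p, c p • hat p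

/-- The stiffness matrix `A`. -/
def stiffness (N r : ℕ) (κ : ℝ × ℝ → ℝ) : Matrix (Node N r) (Node N r) ℝ :=
  Matrix.of fun p q => energy κ (hat p) (hat q)

namespace DualNodes

variable {N r : ℕ} {κ : ℝ × ℝ → ℝ} {X : AuxBasis N r κ} (D : DualNodes X)

/-- `p` is one of the dual nodes. -/
def IsDual (p : Node N r) : Prop := ∃ i j, D.node i j = p

/-- The normalized hat function of the dual node `p_j^{(i)}`. -/
def phiHat (i : Coarse N) (j : Fin (X.L i)) : ℝ × ℝ → ℝ := hatLoc κ i (D.node i j)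

/-- The matrix `S_i`. -/
def S (i : Coarse N) : Matrix (Fin (X.L i)) (Fin (X.L i)) ℝ :=
  Matrix.of fun j l => massOn κ i (D.phiHat i j) (X.psiAux i l)

/-- The dual functions. -/
def phiDual (i : Coarse N) (j : Fin (X.L i)) : ℝ × ℝ → ℝ := ∑ l, (D.S i)⁻¹ j l • D.phiHat i l

/-- `M_i`: the 2-norm of the Gram matrix of the dual functions of `K_i`. -/
def MLoc (i : Coarse N) : ℝ :=
  ‖Matrix.toEuclideanCLM (𝕜 := ℝ)
    (Matrix.of fun j l : Fin (X.L i) => energy κ (D.phiDual i j) (D.phiDual i l))‖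

/-- `M = max_i M_i`. -/
def M : ℝ := ⨆ i, D.MLoc i

/-- The combination of dual functions with the same image under `Π_aux` as `φ_p`. -/
def phiTilde (p : Node N r) : ℝ × ℝ → ℝ :=
  ∑ i, ∑ j, massOn κ i (hatNormalized κ p) (X.psiAux i j) • D.phiDual i j

/-- The vector representing the kernel function `φ_p - φ̃_p`. -/
def kerVec (p : Node N r) : Node N r → ℝ := coeffs (hatNormalized κ p - D.phiTilde p)

/-! #### The special basis of the kernel

`ord` lists all interior vertices of the fine mesh; it gives the order in which the vectors are
passed to the Gram–Schmidt algorithm. -/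

variable (ord : List (Node N r))

open Classical in
/-- The vectors of the non-dual vertices `(a h, b h)` with `P a b`. -/
def group (P : ℕ → ℕ → Prop) : List (Node N r → ℝ) :=
  (ord.filter fun p => P (p.1 + 1) (p.2 + 1) ∧ ¬ D.IsDual p).map D.kerVec

/-- Basis vectors of the interior of the coarse element `(I, J)`. -/
def elemVecs (I J : ℕ) : List (Node N r → ℝ) :=
  mgs (stiffness N r κ) (D.group ord fun a b =>
    (I * r < a ∧ a < (I + 1) * r) ∧ (J * r < b ∧ b < (J + 1) * r))

/-- Basis vectors of the vertical edge shared by the coarse elements `(I, J)` and `(I+1, J)`. -/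
def vEdgeVecs (I J : ℕ) : List (Node N r → ℝ) :=
  mgs (stiffness N r κ) ((D.group ord fun a b =>
    a = (I + 1) * r ∧ (J * r < b ∧ b < (J + 1) * r)).map
      (orthAgainst (stiffness N r κ) (D.elemVecs ord I J ++ D.elemVecs ord (I + 1) J)))

/-- Basis vectors of the horizontal edge shared by the coarse elements `(I, J)` and `(I, J+1)`. -/
def hEdgeVecs (I J : ℕ) : List (Node N r → ℝ) :=
  mgs (stiffness N r κ) ((D.group ord fun a b =>
    (I * r < a ∧ a < (I + 1) * r) ∧ b = (J + 1) * r).map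
      (orthAgainst (stiffness N r κ) (D.elemVecs ord I J ++ D.elemVecs ord I (J + 1))))

/-- The (singleton list of the) basis vector of the coarse vertex `((I+1) H, (J+1) H)`. Applied to
a single vector, the Gram–Schmidt algorithm just normalizes it. -/
def vertexVecs (I J : ℕ) : List (Node N r → ℝ) :=
  mgs (stiffness N r κ) ((D.group ord fun a b => a = (I + 1) * r ∧ b = (J + 1) * r).map
    (orthAgainst (stiffness N r κ)
      (D.elemVecs ord I J ++ D.elemVecs ord (I + 1) J ++
        D.elemVecs ord I (J + 1) ++ D.elemVecs ord (I + 1) (J + 1) ++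
        D.vEdgeVecs ord I J ++ D.vEdgeVecs ord I (J + 1) ++
        D.hEdgeVecs ord I J ++ D.hEdgeVecs ord (I + 1) J)))

/-- All special basis vectors. -/
def basisVecs : List (Node N r → ℝ) :=
  ((List.range N).flatMap fun I => (List.range N).flatMap fun J => D.elemVecs ord I J) ++
  ((List.range (N - 1)).flatMap fun I => (List.range N).flatMap fun J => D.vEdgeVecs ord I J) ++
  ((List.range N).flatMap fun I => (List.range (N - 1)).flatMap fun J => D.hEdgeVecs ord I J) ++
  ((List.range (N - 1)).flatMap fun I =>
    (List.range (N - 1)).flatMap fun J => D.vertexVecs ord I J)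

/-- The matrix `K` whose columns are the special basis vectors. -/
def K : Matrix (Node N r) (Fin (D.basisVecs ord).length) ℝ :=
  Matrix.of fun p c => (D.basisVecs ord).get c p

/-- The matrix `Kᵀ A K`. -/
def KAK : Matrix (Fin (D.basisVecs ord).length) (Fin (D.basisVecs ord).length) ℝ :=
  (D.K ord)ᵀ * stiffness N r κ * D.K ord

/-- `q = (√𝔎 - 1) / (√𝔎 + 1)`, with `𝔎` the condition number of `Kᵀ A K`. -/
def q : ℝ := (√(condNumber (D.KAK ord)) - 1) / (√(condNumber (D.KAK ord)) + 1)

/-- The localized correction of `φ̂_j^{(i)}`, computed by `k` conjugate gradient iterations for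
`Kᵀ A K x = Kᵀ A f_j^{(i)}`. -/
def corrector (k : ℕ) (i : Coarse N) (j : Fin (X.L i)) : ℝ × ℝ → ℝ :=
  ofCoeffs (D.K ord *ᵥ
    cg (D.KAK ord) ((D.K ord)ᵀ *ᵥ (stiffness N r κ *ᵥ coeffs (D.phiHat i j))) k)

/-- The localized multiscale space. -/
def VmsLocal (k : ℕ) : Submodule ℝ (ℝ × ℝ → ℝ) :=
  Submodule.span ℝ (Set.range fun s : (Σ i : Coarse N, Fin (X.L i)) =>
    D.phiHat s.1 s.2 - D.corrector ord k s.1 s.2)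

end DualNodes

end SpectralLOD

end

noncomputable section

namespace SpectralLOD

/-! ### Chebyshev polynomials -/

section Chebyshev

open Polynomial

/-! The ideal multiscale space is spanned by the functions `φ̂ - Cφ̂`, where `C` is the
`a`-orthogonal projection onto the kernel of `Π_aux` and `φ̂` runs over the hat functions of the
dual nodes. The columns of `K` form a basis of that kernel: Gram–Schmidt and the subtracted
projections do not change the span of the vectors `v_p` (`listSpan_basisVecs`), this span is the
whole kernel (`kerCoeffs_eq_kerSpan`), and there are no more columns than its dimension
(`length_basisVecs_le`). Hence `Kᵀ A K x = Kᵀ A f` is the Galerkin equation for `Cφ̂`, and its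
energy norm is that of `a`. The Chebyshev bound for conjugate gradients (`cg_error_bound`), together
with `‖Cφ̂‖_a ≤ ‖φ̂‖_a = 1`, bounds the error of each iterative corrector by `ε = 2q^k/(1+q^{2k})`
(`exists_corrector`).

Expand the ideal solution as `∑ c_s (φ̂_s - Cφ̂_s)` and keep the coordinates `c_s` while replacing
`C` by the iterative corrector. This changes the function by at most `ε ∑ |c_s| ≤ ε √L (∑
c_s²)^{1/2}` in energy norm, and by Galerkin best approximation the discrete solution is at least as
close to `u_h` as this competitor.

It remains to bound the coordinates (`sum_sq_msCoord_le`). On `K_i` they are `S_i^{-T} d`, with `d`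
the vector of moments `s_i(u, ψ_j)`. Separation of the dual nodes makes their hats `a`-orthonormal,
so the Gram matrix of the dual functions is `S_i⁻¹ S_i⁻ᵀ` and `|S_i^{-T} d|² ≤ M_i |d|²`. Bessel's
inequality gives `|d|² ≤ s_i(u, u)`, and summation yields `M H⁻² β ‖u‖²` in `L²`. Finally `‖u‖ ≤
‖f‖` in `L²`, by the Friedrichs inequality with constant `1` (`friedrichs`,
`integral_sq_le_of_isGalerkin`). -/

lemma chebyshev_T_eval_joukowski {z : ℝ} (hz : z ≠ 0) (k : ℕ) :
    (Polynomial.Chebyshev.T ℝ k).eval ((z + z⁻¹) / 2) = (z ^ k + z⁻¹ ^ k) / 2 := by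
  induction k using Nat.twoStepInduction with
  | zero => simp
  | one => simp
  | more n h₁ h₂ =>
    have e : ((n + 2 : ℕ) : ℤ) = (n : ℤ) + 2 := by push_cast; ring
    rw [e, Polynomial.Chebyshev.T_add_two]
    have e' : ((n : ℤ) + 1) = ((n + 1 : ℕ) : ℤ) := by push_cast; ring
    rw [e']
    simp only [eval_sub, eval_mul, eval_ofNat, eval_X, h₁, h₂]
    have hw : z * z⁻¹ = 1 := mul_inv_cancel₀ hz
    linear_combination (z ^ n + z⁻¹ ^ n) / 2 * hw

/-- The polynomial is `T_k` transplanted affinely from `[a, b]` to `[-1, 1]` and normalized at `0`.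
The point `0` goes to `(b+a)/(b-a) = (q + q⁻¹)/2`, where `T_k` equals `(q^k + q^{-k})/2`, the
reciprocal of the bound. -/
lemma exists_polynomial_abs_eval_le {a b : ℝ} (ha : 0 < a) (hab : a ≤ b) (k : ℕ) {q : ℝ}
    (hq : q = (√(b / a) - 1) / (√(b / a) + 1)) :
    ∃ p : ℝ[X], p.natDegree ≤ k ∧ p.eval 0 = 1 ∧
      ∀ t ∈ Set.Icc a b, |p.eval t| ≤ 2 * q ^ k / (1 + q ^ (2 * k)) := by
  rcases hab.eq_or_lt with rfl | hlt
  -- For `a = b` the affine map degenerates. Here `q = 0`, so the bound is `1` for `k = 0` and `0`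
  -- otherwise; in the latter case `1 - X/a` vanishes at the only point.
  · have hq0 : q = 0 := by rw [hq, div_self ha.ne']; simp
    rcases Nat.eq_zero_or_pos k with rfl | hk
    · refine ⟨1, by simp, by simp, fun t _ => ?_⟩
      norm_num
    · refine ⟨1 - C (1 / a) * X, ?_, by simp, fun t ht => ?_⟩
      · compute_degree
        omega
      · have : t = a := le_antisymm ht.2 ht.1
        subst this
        rw [hq0]
        simp [ha.ne', hk.ne']
  · set s := √(b / a) with hs
    have hb0 : 0 < b := ha.trans hlt
    have hs2 : s ^ 2 = b / a := Real.sq_sqrt (by positivity)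
    have hs1 : 1 < s := by
      rw [hs, Real.lt_sqrt (by norm_num), one_pow, one_lt_div ha]
      exact hlt
    have hq0 : 0 < q := by rw [hq]; exact div_pos (by linarith) (by linarith)
    have hb : b = s ^ 2 * a := by rw [hs2]; field_simp
    have hba : 0 < b - a := by linarith
    have hs21 : 0 < s ^ 2 - 1 := by nlinarith
    have hy : (b + a) / (b - a) = (q + q⁻¹) / 2 := by
      rw [hq, hb]
      have h1 : s - 1 ≠ 0 := by linarith
      have h2 : s + 1 ≠ 0 := by linarith
      have h3 : s ^ 2 * a - a ≠ 0 := by rw [← hb]; exact hba.ne'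
      have h4 : s ^ 2 - 1 ≠ 0 := hs21.ne'
      rw [div_eq_div_iff h3 (by norm_num), inv_div]
      field_simp
      ring
    have hT : (Chebyshev.T ℝ k).eval ((b + a) / (b - a)) = (1 + q ^ (2 * k)) / (2 * q ^ k) := by
      rw [hy, chebyshev_T_eval_joukowski hq0.ne']
      have : q ^ k ≠ 0 := by positivity
      rw [inv_pow]
      field_simp
      ring
    have hTpos : 0 < (1 + q ^ (2 * k)) / (2 * q ^ k) := by positivity
    refine ⟨C (2 * q ^ k / (1 + q ^ (2 * k))) *
      (Chebyshev.T ℝ k).comp (C ((b + a) / (b - a)) - C (2 / (b - a)) * X), ?_, ?_, ?_⟩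
    · refine (natDegree_C_mul_le _ _).trans (natDegree_comp_le.trans ?_)
      have h1 : (C ((b + a) / (b - a)) - C (2 / (b - a)) * X : ℝ[X]).natDegree ≤ 1 := by
        compute_degree
      have h2 : (Chebyshev.T ℝ (k : ℤ)).natDegree = k := by simp
      rw [h2]
      calc k * _ ≤ k * 1 := Nat.mul_le_mul_left _ h1
        _ = k := mul_one k
    · simp only [eval_mul, eval_C, eval_comp, eval_sub, eval_X, mul_zero, sub_zero, hT]
      have : q ^ k ≠ 0 := by positivity
      have : 1 + q ^ (2 * k) ≠ 0 := by positivity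
      field_simp
    · intro t ht
      simp only [eval_mul, eval_C, eval_comp, eval_sub, eval_X]
      rw [abs_mul, abs_of_pos (by positivity)]
      refine mul_le_of_le_one_right (by positivity) ?_
      have hx : |(b + a) / (b - a) - 2 / (b - a) * t| ≤ 1 := by
        have : (b + a) / (b - a) - 2 / (b - a) * t = (b + a - 2 * t) / (b - a) := by
          field_simp
        rw [this, abs_div, abs_of_pos hba, div_le_one hba, abs_le]
        constructor <;> linarith [ht.1, ht.2]
      exact Chebyshev.abs_eval_T_real_le_one _ hx

end Chebyshev

/-! ### Real symmetric positive definite matrices -/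

section Form

variable {ι : Type} [Fintype ι] {A : Matrix ι ι ℝ}

lemma dotProduct_mulVec_symm (hA : A.IsHermitian) (x y : ι → ℝ) :
    x ⬝ᵥ (A *ᵥ y) = y ⬝ᵥ (A *ᵥ x) := by
  have hT : Aᵀ = A := by simpa [Matrix.conjTranspose_eq_transpose_of_trivial] using hA.eq
  rw [dotProduct_mulVec, dotProduct_comm, ← mulVec_transpose, hT]

lemma form_nonneg (hA : A.PosDef) (x : ι → ℝ) : 0 ≤ x ⬝ᵥ (A *ᵥ x) := by
  simpa using hA.posSemidef.dotProduct_mulVec_nonneg x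

lemma form_self_eq_zero (hA : A.PosDef) {x : ι → ℝ} (h : x ⬝ᵥ (A *ᵥ x) = 0) : x = 0 := by
  by_contra hx
  have := hA.dotProduct_mulVec_pos hx
  simp only [star_trivial] at this
  exact this.ne' h

lemma form_add_self (hA : A.IsHermitian) (x y : ι → ℝ) :
    (x + y) ⬝ᵥ (A *ᵥ (x + y)) = x ⬝ᵥ (A *ᵥ x) + 2 * (x ⬝ᵥ (A *ᵥ y)) + y ⬝ᵥ (A *ᵥ y) := by
  rw [mulVec_add, add_dotProduct, dotProduct_add, dotProduct_add, dotProduct_mulVec_symm hA y x]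
  ring

lemma form_cauchy_schwarz (hA : A.PosDef) (x y : ι → ℝ) :
    (x ⬝ᵥ (A *ᵥ y)) ^ 2 ≤ (x ⬝ᵥ (A *ᵥ x)) * (y ⬝ᵥ (A *ᵥ y)) := by
  have h : ∀ t : ℝ, 0 ≤ (y ⬝ᵥ (A *ᵥ y)) * (t * t) + (2 * (x ⬝ᵥ (A *ᵥ y))) * t +
      x ⬝ᵥ (A *ᵥ x) := by
    intro t
    have := form_nonneg hA (x + t • y)
    rw [form_add_self hA.isHermitian] at this
    simp only [mulVec_smul, dotProduct_smul, smul_dotProduct, smul_eq_mul] at this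
    linarith
  have := discrim_le_zero h
  rw [discrim] at this
  nlinarith

lemma sqrt_form_add_le (hA : A.PosDef) (x y : ι → ℝ) :
    √((x + y) ⬝ᵥ (A *ᵥ (x + y))) ≤ √(x ⬝ᵥ (A *ᵥ x)) + √(y ⬝ᵥ (A *ᵥ y)) := by
  have hx := form_nonneg hA x
  have hy := form_nonneg hA y
  have h : x ⬝ᵥ (A *ᵥ y) ≤ √(x ⬝ᵥ (A *ᵥ x)) * √(y ⬝ᵥ (A *ᵥ y)) := by
    rw [← Real.sqrt_mul hx]
    exact Real.le_sqrt_of_sq_le (form_cauchy_schwarz hA x y)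
  rw [Real.sqrt_le_left (by positivity), form_add_self hA.isHermitian]
  nlinarith [Real.sq_sqrt hx, Real.sq_sqrt hy]

lemma sqrt_form_smul (t : ℝ) (x : ι → ℝ) :
    √((t • x) ⬝ᵥ (A *ᵥ (t • x))) = |t| * √(x ⬝ᵥ (A *ᵥ x)) := by
  simp only [mulVec_smul, dotProduct_smul, smul_dotProduct, smul_eq_mul]
  rw [← mul_assoc, Real.sqrt_mul (mul_self_nonneg t), Real.sqrt_mul_self_eq_abs]

lemma sqrt_form_sum_le (hA : A.PosDef) {σ : Type} (s : Finset σ) (v : σ → ι → ℝ) :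
    √((∑ i ∈ s, v i) ⬝ᵥ (A *ᵥ (∑ i ∈ s, v i))) ≤ ∑ i ∈ s, √(v i ⬝ᵥ (A *ᵥ v i)) := by
  classical
  induction s using Finset.induction_on with
  | empty => simp
  | insert a s ha ih =>
    rw [Finset.sum_insert ha, Finset.sum_insert ha]
    exact (sqrt_form_add_le hA _ _).trans (by gcongr)

/-- Galerkin orthogonality implies best approximation. -/
lemma form_le_form_add (hA : A.PosDef) {x y : ι → ℝ} (h : x ⬝ᵥ (A *ᵥ y) = 0) :
    x ⬝ᵥ (A *ᵥ x) ≤ (x + y) ⬝ᵥ (A *ᵥ (x + y)) := by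
  rw [form_add_self hA.isHermitian, h]
  linarith [form_nonneg hA y]

lemma aeval_mulVec_of_mulVec_eq_smul [DecidableEq ι] {v : ι → ℝ} {μ : ℝ} (h : A *ᵥ v = μ • v)
    (p : Polynomial ℝ) : (Polynomial.aeval A p) *ᵥ v = p.eval μ • v := by
  induction p using Polynomial.induction_on' with
  | add p q hp hq => rw [map_add, add_mulVec, hp, hq, Polynomial.eval_add, add_smul]
  | monomial n a =>
    have hn : ∀ n : ℕ, (A ^ n) *ᵥ v = μ ^ n • v := by
      intro n
      induction n with
      | zero => simp
      | succ n ih => rw [pow_succ, ← mulVec_mulVec, h, mulVec_smul, ih, smul_smul, pow_succ']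
    rw [Polynomial.aeval_monomial, Polynomial.eval_monomial, ← Algebra.smul_def, smul_mulVec, hn,
      smul_smul]

/-- A polynomial in a positive definite matrix acts on the energy norm through its values on the
spectrum. -/
lemma sqrt_form_aeval_le [DecidableEq ι] (hA : A.PosDef) (p : Polynomial ℝ) {ε : ℝ} (hε : 0 ≤ ε)
    (hp : ∀ t ∈ spectrum ℝ A, |p.eval t| ≤ ε) (x : ι → ℝ) :
    √(((Polynomial.aeval A p) *ᵥ x) ⬝ᵥ (A *ᵥ ((Polynomial.aeval A p) *ᵥ x))) ≤
      ε * √(x ⬝ᵥ (A *ᵥ x)) := by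
  have hH := hA.isHermitian
  set b := hH.eigenvectorBasis with hb
  set e : ι → ι → ℝ := fun j => (b j).ofLp with he
  have hAe : ∀ j, A *ᵥ e j = hH.eigenvalues j • e j := fun j => hH.mulVec_eigenvectorBasis j
  have hee : ∀ i j, e i ⬝ᵥ e j = if i = j then 1 else 0 := by
    intro i j
    have := orthonormal_iff_ite.mp b.orthonormal j i
    rw [EuclideanSpace.inner_eq_star_dotProduct] at this
    simpa [he, eq_comm] using this
  have hform : ∀ d : ι → ℝ, (∑ j, d j • e j) ⬝ᵥ (A *ᵥ (∑ j, d j • e j)) =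
      ∑ j, hH.eigenvalues j * d j ^ 2 := by
    intro d
    rw [mulVec_sum, sum_dotProduct]
    refine Finset.sum_congr rfl fun i _ => ?_
    rw [dotProduct_sum, Finset.sum_eq_single i]
    · simp only [mulVec_smul, hAe, dotProduct_smul, smul_dotProduct, hee, smul_eq_mul, if_true]
      ring
    · intro j _ hj
      simp [mulVec_smul, hAe, hee, hj.symm]
    · simp
  obtain ⟨c, hc⟩ : ∃ c : ι → ℝ, x = ∑ j, c j • e j := by
    refine ⟨fun j => b.repr (WithLp.toLp 2 x) j, ?_⟩
    have := congrArg WithLp.ofLp (b.sum_repr (WithLp.toLp 2 x))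
    rw [WithLp.ofLp_sum] at this
    simpa [he] using this.symm
  have hpx : (Polynomial.aeval A p) *ᵥ x =
      ∑ j, (c j * p.eval (hH.eigenvalues j)) • e j := by
    rw [hc, mulVec_sum]
    refine Finset.sum_congr rfl fun j _ => ?_
    rw [mulVec_smul, aeval_mulVec_of_mulVec_eq_smul (hAe j), smul_smul]
  rw [hpx, hform, hc, hform, ← Real.sqrt_sq hε, ← Real.sqrt_mul (sq_nonneg ε), Finset.mul_sum]
  refine Real.sqrt_le_sqrt (Finset.sum_le_sum fun j _ => ?_)
  have hpos := hA.eigenvalues_pos j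
  have hle : p.eval (hH.eigenvalues j) ^ 2 ≤ ε ^ 2 :=
    sq_le_sq' (abs_le.mp (hp _ (hH.eigenvalues_mem_spectrum_real j))).1
      (abs_le.mp (hp _ (hH.eigenvalues_mem_spectrum_real j))).2
  have : 0 ≤ hH.eigenvalues j * c j ^ 2 := by positivity
  nlinarith

end Form

/-! ### Conjugate gradients -/

section CG

open Polynomial

variable {ι : Type} [Fintype ι] [DecidableEq ι] (B : Matrix ι ι ℝ) (b : ι → ℝ)

/-- The Krylov space spanned by `b, B b, …, B^(k-1) b`. -/
def krylov (k : ℕ) : Submodule ℝ (ι → ℝ) :=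
  (degreeLT ℝ k).map ((Matrix.mulVecBilin ℝ ℝ).flip b ∘ₗ (aeval B).toLinearMap)

variable {B b}

lemma mem_krylov {k : ℕ} {x : ι → ℝ} :
    x ∈ krylov B b k ↔ ∃ g : ℝ[X], g.degree < k ∧ (aeval B g) *ᵥ b = x := by
  simp [krylov, mem_degreeLT]

lemma krylov_mono {k : ℕ} {x : ι → ℝ} (hx : x ∈ krylov B b k) : x ∈ krylov B b (k + 1) := by
  obtain ⟨g, hg, rfl⟩ := mem_krylov.mp hx
  exact mem_krylov.mpr ⟨g, hg.trans (by exact_mod_cast Nat.lt_succ_self k), rfl⟩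

lemma mulVec_mem_krylov {k : ℕ} {x : ι → ℝ} (hx : x ∈ krylov B b k) :
    B *ᵥ x ∈ krylov B b (k + 1) := by
  obtain ⟨g, hg, rfl⟩ := mem_krylov.mp hx
  refine mem_krylov.mpr ⟨X * g, ?_, by simp [mulVec_mulVec]⟩
  rcases eq_or_ne g 0 with rfl | h0
  · simp
  · rw [degree_eq_natDegree h0] at hg
    rw [degree_mul, degree_X, degree_eq_natDegree h0]
    have : g.natDegree < k := by exact_mod_cast hg
    have h2 : 1 + g.natDegree < k + 1 := by omega
    exact_mod_cast h2

lemma mem_krylov_zero {x : ι → ℝ} (hx : x ∈ krylov B b 0) : x = 0 := by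
  obtain ⟨g, hg, rfl⟩ := mem_krylov.mp hx
  have : g = 0 := by simpa using hg
  simp [this]

/-- An element of the next Krylov space is determined up to a multiple of `B^k b`. -/
lemma exists_krylov_succ {k : ℕ} {x : ι → ℝ} (hx : x ∈ krylov B b (k + 1)) :
    ∃ w ∈ krylov B b k, ∃ t : ℝ, x = w + t • ((B ^ k) *ᵥ b) := by
  obtain ⟨g, hg, rfl⟩ := mem_krylov.mp hx
  refine ⟨_, mem_krylov.mpr ⟨g - monomial k (g.coeff k), ?_, rfl⟩, g.coeff k, ?_⟩
  · rw [degree_lt_iff_coeff_zero]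
    intro m hm
    rw [coeff_sub, coeff_monomial]
    rcases hm.eq_or_lt with rfl | hlt
    · simp
    · rw [if_neg hlt.ne, sub_zero]
      exact coeff_eq_zero_of_degree_lt (hg.trans_le (by exact_mod_cast hlt))
  · rw [map_sub, sub_mulVec, aeval_monomial, ← Algebra.smul_def, smul_mulVec]
    abel

/-- The invariant of the conjugate gradient iteration. -/
structure CGInvariant (B : Matrix ι ι ℝ) (b : ι → ℝ) (k : ℕ)
    (s : (ι → ℝ) × (ι → ℝ) × (ι → ℝ)) : Prop where
  iterate_mem : s.1 ∈ krylov B b k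
  residual_eq : s.2.1 = b - B *ᵥ s.1
  residual_mem : s.2.1 ∈ krylov B b (k + 1)
  residual_orth : ∀ w ∈ krylov B b k, s.2.1 ⬝ᵥ w = 0
  direction_conj : ∀ w ∈ krylov B b k, s.2.2 ⬝ᵥ (B *ᵥ w) = 0
  direction_sub_mem : s.2.2 - s.2.1 ∈ krylov B b k

lemma cgInvariant_zero : CGInvariant B b 0 (0, b, b) where
  iterate_mem := zero_mem _
  residual_eq := by simp
  residual_mem := mem_krylov.mpr ⟨1, by simp, by simp⟩
  residual_orth w hw := by simp [mem_krylov_zero hw]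
  direction_conj w hw := by simp [mem_krylov_zero hw]
  direction_sub_mem := by simp

/-- The next Krylov space is the current one plus the line of `p`, so each orthogonality has two
parts. The part against the old Krylov space follows from the invariant or from orthogonality of the
new residual; the part against `p` is what `α` and `γ` are chosen for. -/
lemma CGInvariant.step (hB : B.PosDef) {k : ℕ} {s : (ι → ℝ) × (ι → ℝ) × (ι → ℝ)}
    (h : CGInvariant B b k s) : CGInvariant B b (k + 1) (cgStep B s) := by
  obtain ⟨x, res, p⟩ := s
  obtain ⟨hx, hres, hresm, ho, hc, hd⟩ := h
  simp only at hx hres hresm ho hc hd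
  by_cases h0 : res = 0
  · subst h0
    -- With zero residual, `p` lies in the Krylov space to which it is conjugate, so it is conjugate
    -- to itself. The state is then stationary because `0 / 0 = 0`.
    have hp : p = 0 := by
      rw [sub_zero] at hd
      exact form_self_eq_zero hB (hc p hd)
    subst hp
    have : cgStep B (x, 0, 0) = (x, 0, 0) := by simp [cgStep]
    rw [this]
    exact ⟨krylov_mono hx, hres, zero_mem _, by simp, by simp, by simp⟩
  · have hrr : res ⬝ᵥ res ≠ 0 := by simpa [dotProduct_self_eq_zero] using h0
    have hrp : res ⬝ᵥ p = res ⬝ᵥ res := by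
      have := ho _ hd
      rw [dotProduct_sub] at this
      linarith
    have hp0 : p ≠ 0 := by
      rintro rfl
      exact hrr (by rw [← hrp, dotProduct_zero])
    have hpBp : p ⬝ᵥ (B *ᵥ p) ≠ 0 := fun h => hp0 (form_self_eq_zero hB h)
    have hpm : p ∈ krylov B b (k + 1) := by
      have := add_mem (krylov_mono hd) hresm
      simpa using this
    have hsucc : ∀ y ∈ krylov B b (k + 1), ∃ w ∈ krylov B b k, ∃ t : ℝ, y = w + t • p := by
      intro y hy
      obtain ⟨w₁, hw₁, t₁, e₁⟩ := exists_krylov_succ hpm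
      obtain ⟨w₂, hw₂, t₂, e₂⟩ := exists_krylov_succ hy
      -- If `p` had no `B^k b` component it would lie in the old Krylov space and be conjugate to
      -- itself.
      have ht : t₁ ≠ 0 := by
        rintro rfl
        have hpk : p ∈ krylov B b k := by rw [e₁]; simpa using hw₁
        exact hpBp (hc p hpk)
      refine ⟨w₂ - (t₂ / t₁) • w₁, sub_mem hw₂ (Submodule.smul_mem _ _ hw₁), t₂ / t₁, ?_⟩
      rw [e₂, e₁, smul_add, smul_smul, div_mul_cancel₀ _ ht]
      abel
    set α := (res ⬝ᵥ res) / (p ⬝ᵥ (B *ᵥ p)) with hα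
    set res' := res - α • (B *ᵥ p) with hres'
    set γ := (res' ⬝ᵥ res') / (res ⬝ᵥ res) with hγ
    have hα0 : α ≠ 0 := div_ne_zero hrr hpBp
    have hstep : cgStep B (x, res, p) = (x + α • p, res', res' + γ • p) := rfl
    rw [hstep]
    have ho' : ∀ w ∈ krylov B b (k + 1), res' ⬝ᵥ w = 0 := by
      intro y hy
      obtain ⟨w, hw, t, rfl⟩ := hsucc y hy
      have e1 : (B *ᵥ p) ⬝ᵥ w = 0 := by
        rw [dotProduct_comm, dotProduct_mulVec_symm hB.isHermitian, hc w hw]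
      have e2 : (B *ᵥ p) ⬝ᵥ p = p ⬝ᵥ (B *ᵥ p) := dotProduct_comm _ _
      simp only [hres', sub_dotProduct, dotProduct_add, dotProduct_smul, smul_dotProduct,
        smul_eq_mul, ho w hw, e1, e2, hrp, hα]
      field_simp
      ring
    refine ⟨add_mem (krylov_mono hx) (Submodule.smul_mem _ _ hpm), ?_, ?_, ho', ?_, ?_⟩
    · simp only [hres', hres, mulVec_add, mulVec_smul]
      abel
    · exact sub_mem (krylov_mono hresm) (Submodule.smul_mem _ _ (mulVec_mem_krylov hpm))
    · intro y hy
      obtain ⟨w, hw, t, rfl⟩ := hsucc y hy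
      have e1 : res' ⬝ᵥ (B *ᵥ w) = 0 := ho' _ (mulVec_mem_krylov hw)
      -- Pair the recurrence for `res'` with `res'` itself, which is orthogonal to `res`.
      have e2 : α * (res' ⬝ᵥ (B *ᵥ p)) = - (res' ⬝ᵥ res') := by
        have h1 : res' ⬝ᵥ res' = res' ⬝ᵥ res - α * (res' ⬝ᵥ (B *ᵥ p)) := by
          conv_lhs => rw [hres', dotProduct_sub, dotProduct_smul, smul_eq_mul, ← hres']
        rw [ho' _ hresm] at h1
        linarith
      have e3 : α * (γ * (p ⬝ᵥ (B *ᵥ p))) = res' ⬝ᵥ res' := by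
        rw [hα, hγ]
        field_simp
      have e4 : res' ⬝ᵥ (B *ᵥ p) + γ * (p ⬝ᵥ (B *ᵥ p)) = 0 := by
        have : α * (res' ⬝ᵥ (B *ᵥ p) + γ * (p ⬝ᵥ (B *ᵥ p))) = 0 := by
          rw [mul_add, e2, e3]
          ring
        exact (mul_eq_zero.mp this).resolve_left hα0
      simp only [add_dotProduct, mulVec_add, mulVec_smul, dotProduct_add, dotProduct_smul,
        smul_dotProduct, smul_eq_mul, e1, hc w hw]
      linear_combination t * e4
    · simpa using Submodule.smul_mem _ γ hpm

lemma cgInvariant_iterate (hB : B.PosDef) (k : ℕ) :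
    CGInvariant B b k ((cgStep B)^[k] (0, b, b)) := by
  induction k with
  | zero => exact cgInvariant_zero
  | succ k ih =>
    rw [Function.iterate_succ_apply']
    exact ih.step hB

/-- The conjugate gradient iterate minimizes the energy norm of the error over the Krylov space. -/
lemma cg_error_le (hB : B.PosDef) {x : ι → ℝ} (hx : B *ᵥ x = b) (k : ℕ) {y : ι → ℝ}
    (hy : y ∈ krylov B b k) :
    √((x - cg B b k) ⬝ᵥ (B *ᵥ (x - cg B b k))) ≤ √((x - y) ⬝ᵥ (B *ᵥ (x - y))) := by
  have h := cgInvariant_iterate (b := b) hB k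
  have hz : cg B b k - y ∈ krylov B b k := sub_mem h.iterate_mem hy
  have horth : (x - cg B b k) ⬝ᵥ (B *ᵥ (cg B b k - y)) = 0 := by
    rw [dotProduct_mulVec_symm hB.isHermitian, mulVec_sub, hx, dotProduct_comm]
    have := h.residual_orth _ hz
    rwa [h.residual_eq] at this
  have := form_le_form_add hB horth
  rw [sub_add_sub_cancel] at this
  exact Real.sqrt_le_sqrt this

/-- The classical convergence estimate of the conjugate gradient method. -/
theorem cg_error_bound [Nonempty ι] (hB : B.PosDef) {x : ι → ℝ} (hx : B *ᵥ x = b) (k : ℕ) {q : ℝ}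
    (hq : q = (√(condNumber B) - 1) / (√(condNumber B) + 1)) :
    √((x - cg B b k) ⬝ᵥ (B *ᵥ (x - cg B b k))) ≤
      2 * q ^ k / (1 + q ^ (2 * k)) * √(x ⬝ᵥ (B *ᵥ x)) := by
  have hne : (spectrum ℝ B).Nonempty :=
    ⟨_, hB.isHermitian.eigenvalues_mem_spectrum_real (Classical.arbitrary ι)⟩
  have hfin : (spectrum ℝ B).Finite := Matrix.finite_real_spectrum
  have hinf := hne.csInf_mem hfin
  have hsup := hne.csSup_mem hfin
  have hpos : 0 < sInf (spectrum ℝ B) := by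
    have := hinf
    rw [hB.isHermitian.spectrum_real_eq_range_eigenvalues] at this
    obtain ⟨j, hj⟩ := this
    rw [hB.isHermitian.spectrum_real_eq_range_eigenvalues, ← hj]
    exact hB.eigenvalues_pos j
  have hle : sInf (spectrum ℝ B) ≤ sSup (spectrum ℝ B) := csInf_le hfin.bddBelow hsup
  obtain ⟨p, hpdeg, hp0, hp⟩ := exists_polynomial_abs_eval_le hpos hle k hq
  have hp' : ∀ t ∈ spectrum ℝ B, |p.eval t| ≤ 2 * q ^ k / (1 + q ^ (2 * k)) := fun t ht =>
    hp t ⟨csInf_le hfin.bddBelow ht, le_csSup hfin.bddAbove ht⟩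
  have hε : 0 ≤ 2 * q ^ k / (1 + q ^ (2 * k)) := (abs_nonneg _).trans (hp' _ hinf)
  -- Since `p(0) = 1`, write `1 - p = X g`. Then `g(B) b` lies in the Krylov space and its error is
  -- `x - g(B) B x = p(B) x`.
  obtain ⟨g, hg⟩ : X ∣ 1 - p := by
    rw [X_dvd_iff, coeff_zero_eq_eval_zero, eval_sub, hp0]
    simp
  have hgdeg : g.degree < k := by
    rcases eq_or_ne g 0 with rfl | h0
    · simp
    · have h1 : (1 - p).natDegree ≤ k := (natDegree_sub_le _ _).trans (by simpa using hpdeg)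
      rw [hg, natDegree_X_mul h0] at h1
      rw [degree_eq_natDegree h0]
      exact_mod_cast h1
  have hy : (aeval B g) *ᵥ b ∈ krylov B b k := mem_krylov.mpr ⟨g, hgdeg, rfl⟩
  refine (cg_error_le hB hx k hy).trans ?_
  have hxy : x - (aeval B g) *ᵥ b = (aeval B p) *ᵥ x := by
    have : p = 1 - g * X := by rw [mul_comm, ← hg]; ring
    rw [this, ← hx, map_sub, map_mul, sub_mulVec, mulVec_mulVec]
    simp
  rw [hxy]
  exact sqrt_form_aeval_le hB p hε hp' x

end CG


/-! ### Spans of Gram–Schmidt vectors -/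

section GramSchmidt

variable {ι : Type}

/-- The span of the entries of a list. -/
def listSpan (l : List (ι → ℝ)) : Submodule ℝ (ι → ℝ) := Submodule.span ℝ {x | x ∈ l}

lemma mem_listSpan {l : List (ι → ℝ)} {x : ι → ℝ} (h : x ∈ l) : x ∈ listSpan l :=
  Submodule.subset_span h

lemma listSpan_le {l : List (ι → ℝ)} {P : Submodule ℝ (ι → ℝ)} :
    listSpan l ≤ P ↔ ∀ x ∈ l, x ∈ P := Submodule.span_le

lemma listSpan_cons (v : ι → ℝ) (l : List (ι → ℝ)) :
    listSpan (v :: l) = Submodule.span ℝ {v} ⊔ listSpan l := by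
  rw [listSpan, listSpan, ← Submodule.span_union]
  congr 1
  ext x
  simp

lemma listSpan_append (l m : List (ι → ℝ)) : listSpan (l ++ m) = listSpan l ⊔ listSpan m := by
  rw [listSpan, listSpan, listSpan, ← Submodule.span_union]
  congr 1
  ext x
  simp

/-- Covers both one Gram–Schmidt sweep and `orthAgainst`: each alters a vector only by an element of
a space already present. -/
lemma sup_listSpan_map {P : Submodule ℝ (ι → ℝ)} {g : (ι → ℝ) → (ι → ℝ)} {l : List (ι → ℝ)}
    (h : ∀ u, u - g u ∈ P) : P ⊔ listSpan (l.map g) = P ⊔ listSpan l := by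
  refine le_antisymm (sup_le le_sup_left (listSpan_le.mpr fun x hx => ?_))
    (sup_le le_sup_left (listSpan_le.mpr fun x hx => ?_))
  · obtain ⟨u, hu, rfl⟩ := List.mem_map.mp hx
    have := sub_mem (Submodule.mem_sup_right (S := P) (mem_listSpan hu))
      (Submodule.mem_sup_left (h u))
    simpa using this
  · have := add_mem (Submodule.mem_sup_left (h x))
      (Submodule.mem_sup_right (S := P) (mem_listSpan (List.mem_map_of_mem (f := g) hx)))
    simpa using this

lemma list_sum_mem_listSpan {l : List (ι → ℝ)} (c : (ι → ℝ) → ℝ) :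
    (l.map fun w => c w • w).sum ∈ listSpan l := by
  refine list_sum_mem fun x hx => ?_
  obtain ⟨w, hw, rfl⟩ := List.mem_map.mp hx
  exact Submodule.smul_mem _ _ (mem_listSpan hw)

variable [Fintype ι] {A : Matrix ι ι ℝ}

/-- No vector is ever dropped, so columns can be counted before their independence is known. -/
lemma length_mgs (l : List (ι → ℝ)) : (mgs A l).length = l.length := by
  induction hn : l.length generalizing l with
  | zero => rw [List.length_eq_zero_iff.mp hn, mgs]; rfl
  | succ n ih =>
    cases l with
    | nil => simp at hn
    | cons v vs =>
      rw [mgs, List.length_cons, ih _ (by simpa using hn)]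

lemma listSpan_mgs (hA : A.PosDef) (l : List (ι → ℝ)) : listSpan (mgs A l) = listSpan l := by
  induction hn : l.length generalizing l with
  | zero => rw [List.length_eq_zero_iff.mp hn, mgs]
  | succ n ih =>
    cases l with
    | nil => simp at hn
    | cons v vs =>
      -- Independence is not required: a zero vector is normalized to zero, and otherwise
      -- definiteness makes the scaling factor nonzero.
      have hspan : Submodule.span ℝ {(√(v ⬝ᵥ (A *ᵥ v)))⁻¹ • v} = Submodule.span ℝ {v} := by
        rcases eq_or_ne v 0 with rfl | hv
        · simp
        · refine Submodule.span_singleton_smul_eq (IsUnit.mk0 _ (inv_ne_zero ?_)) v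
          rw [Real.sqrt_ne_zero (form_nonneg hA v)]
          exact fun h => hv (form_self_eq_zero hA h)
      rw [mgs, listSpan_cons, ih _ (by simpa using hn), hspan, listSpan_cons]
      refine sup_listSpan_map fun u => ?_
      rw [sub_sub_cancel]
      exact Submodule.smul_mem _ _ (hspan ▸ Submodule.mem_span_singleton_self _)

lemma sup_listSpan_mgs_orthAgainst (hA : A.PosDef) (W l : List (ι → ℝ)) :
    listSpan W ⊔ listSpan (mgs A (l.map (orthAgainst A W))) = listSpan W ⊔ listSpan l := by
  rw [listSpan_mgs hA]
  refine sup_listSpan_map fun u => ?_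
  rw [orthAgainst, sub_sub_cancel, ← listSpan_mgs hA W]
  exact list_sum_mem_listSpan _

end GramSchmidt

/-! ### The special basis spans the kernel -/

namespace DualNodes

variable {N r : ℕ} {κ : ℝ × ℝ → ℝ} {X : AuxBasis N r κ} (D : DualNodes X) (ord : List (Node N r))

/-- The span of the kernel vectors of all vertices that are not dual nodes. -/
def kerSpan : Submodule ℝ (Node N r → ℝ) := Submodule.span ℝ (D.kerVec '' {p | ¬ D.IsDual p})

lemma listSpan_group_le (P : ℕ → ℕ → Prop) : listSpan (D.group ord P) ≤ D.kerSpan := by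
  refine listSpan_le.mpr fun x hx => ?_
  simp only [group, List.mem_map, List.mem_filter, decide_eq_true_eq] at hx
  obtain ⟨p, hp, rfl⟩ := hx
  exact Submodule.subset_span ⟨p, hp.2.2, rfl⟩

lemma kerVec_mem_group (hord : ∀ p, p ∈ ord) {P : ℕ → ℕ → Prop} {p : Node N r}
    (hp : ¬ D.IsDual p) (hP : P (p.1 + 1) (p.2 + 1)) :
    D.kerVec p ∈ listSpan (D.group ord P) := by
  refine mem_listSpan ?_
  simp only [group, List.mem_map, List.mem_filter, decide_eq_true_eq]
  exact ⟨p, ⟨hord p, hP, hp⟩, rfl⟩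

lemma listSpan_elemVecs_le (hA : (stiffness N r κ).PosDef) (I J : ℕ) :
    listSpan (D.elemVecs ord I J) ≤ D.kerSpan := by
  rw [elemVecs, listSpan_mgs hA]
  exact D.listSpan_group_le ord _

lemma listSpan_orth_le (hA : (stiffness N r κ).PosDef) {W : List (Node N r → ℝ)}
    (hW : listSpan W ≤ D.kerSpan) (P : ℕ → ℕ → Prop) :
    listSpan (mgs (stiffness N r κ) ((D.group ord P).map (orthAgainst (stiffness N r κ) W))) ≤
      D.kerSpan :=
  calc _ ≤ _ := le_sup_right
    _ = _ := sup_listSpan_mgs_orthAgainst hA W _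
    _ ≤ _ := sup_le hW (D.listSpan_group_le ord P)

/-- The projection that was subtracted lies in the span of `W`, so the original vector is recovered
inside any space containing `W` and the processed group. -/
lemma kerVec_mem_of_orth (hA : (stiffness N r κ).PosDef) (hord : ∀ p, p ∈ ord)
    {W : List (Node N r → ℝ)} {P : ℕ → ℕ → Prop} {p : Node N r}
    (hp : ¬ D.IsDual p) (hP : P (p.1 + 1) (p.2 + 1)) {T : Submodule ℝ (Node N r → ℝ)}
    (hW : listSpan W ≤ T)
    (hT : listSpan (mgs (stiffness N r κ)
      ((D.group ord P).map (orthAgainst (stiffness N r κ) W))) ≤ T) : D.kerVec p ∈ T :=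
  (sup_listSpan_mgs_orthAgainst hA W (D.group ord P)).ge.trans (sup_le hW hT)
    (Submodule.mem_sup_right (D.kerVec_mem_group ord hord hp hP))

lemma listSpan_vEdgeVecs_le (hA : (stiffness N r κ).PosDef) (I J : ℕ) :
    listSpan (D.vEdgeVecs ord I J) ≤ D.kerSpan := by
  refine D.listSpan_orth_le ord hA ?_ _
  rw [listSpan_append]
  exact sup_le (D.listSpan_elemVecs_le ord hA _ _) (D.listSpan_elemVecs_le ord hA _ _)

lemma listSpan_hEdgeVecs_le (hA : (stiffness N r κ).PosDef) (I J : ℕ) :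
    listSpan (D.hEdgeVecs ord I J) ≤ D.kerSpan := by
  refine D.listSpan_orth_le ord hA ?_ _
  rw [listSpan_append]
  exact sup_le (D.listSpan_elemVecs_le ord hA _ _) (D.listSpan_elemVecs_le ord hA _ _)

lemma listSpan_vertexVecs_le (hA : (stiffness N r κ).PosDef) (I J : ℕ) :
    listSpan (D.vertexVecs ord I J) ≤ D.kerSpan := by
  refine D.listSpan_orth_le ord hA ?_ _
  simp only [listSpan_append, sup_le_iff]
  exact ⟨⟨⟨⟨⟨⟨⟨D.listSpan_elemVecs_le ord hA _ _, D.listSpan_elemVecs_le ord hA _ _⟩,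
    D.listSpan_elemVecs_le ord hA _ _⟩, D.listSpan_elemVecs_le ord hA _ _⟩,
    D.listSpan_vEdgeVecs_le ord hA _ _⟩, D.listSpan_vEdgeVecs_le ord hA _ _⟩,
    D.listSpan_hEdgeVecs_le ord hA _ _⟩, D.listSpan_hEdgeVecs_le ord hA _ _⟩

lemma mem_basisVecs {x : Node N r → ℝ} : x ∈ D.basisVecs ord ↔
    (∃ I < N, ∃ J < N, x ∈ D.elemVecs ord I J) ∨
    (∃ I < N - 1, ∃ J < N, x ∈ D.vEdgeVecs ord I J) ∨
    (∃ I < N, ∃ J < N - 1, x ∈ D.hEdgeVecs ord I J) ∨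
    (∃ I < N - 1, ∃ J < N - 1, x ∈ D.vertexVecs ord I J) := by
  simp only [basisVecs, List.mem_append, List.mem_flatMap, List.mem_range, or_assoc]

/-- A grid index strictly between `0` and `N r` is either interior to a coarse interval or an
interior coarse grid point. -/
lemma grid_index_cases (hr : 0 < r) {a : ℕ} (h0 : 0 < a) (ha : a < N * r) :
    (∃ I < N, I * r < a ∧ a < (I + 1) * r) ∨ (∃ I < N - 1, a = (I + 1) * r) := by
  have hdm := Nat.div_add_mod a r
  have hm := Nat.mod_lt a hr
  have hq : a / r < N := (Nat.div_lt_iff_lt_mul hr).mpr ha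
  rcases Nat.eq_zero_or_pos (a % r) with h | h
  · right
    have hpos : 0 < a / r := by
      rcases Nat.eq_zero_or_pos (a / r) with h' | h'
      · rw [h, h'] at hdm
        omega
      · exact h'
    refine ⟨a / r - 1, by omega, ?_⟩
    rw [Nat.sub_add_cancel hpos, mul_comm]
    omega
  · left
    refine ⟨a / r, hq, ?_, ?_⟩
    · rw [mul_comm]; omega
    · rw [add_mul, mul_comm]; omega

/-- Every vertex is reached because each of its two grid indices is either interior to a coarse
interval or a coarse grid point; the four combinations are the element, edge and vertex groups. What
was subtracted in a later group belongs to the spans of earlier ones. -/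
theorem listSpan_basisVecs (hr : 0 < r) (hA : (stiffness N r κ).PosDef) (hord : ∀ p, p ∈ ord) :
    listSpan (D.basisVecs ord) = D.kerSpan := by
  refine le_antisymm (listSpan_le.mpr fun x hx => ?_) (Submodule.span_le.mpr ?_)
  · rcases (D.mem_basisVecs ord).mp hx with ⟨I, _, J, _, h⟩ | ⟨I, _, J, _, h⟩ | ⟨I, _, J, _, h⟩ |
      ⟨I, _, J, _, h⟩
    · exact D.listSpan_elemVecs_le ord hA I J (mem_listSpan h)
    · exact D.listSpan_vEdgeVecs_le ord hA I J (mem_listSpan h)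
    · exact D.listSpan_hEdgeVecs_le ord hA I J (mem_listSpan h)
    · exact D.listSpan_vertexVecs_le ord hA I J (mem_listSpan h)
  · rintro _ ⟨p, hp, rfl⟩
    set T := listSpan (D.basisVecs ord) with hT
    have hE : ∀ I < N, ∀ J < N, listSpan (D.elemVecs ord I J) ≤ T := fun I hI J hJ =>
      listSpan_le.mpr fun x hx => mem_listSpan ((D.mem_basisVecs ord).mpr
        (Or.inl ⟨I, hI, J, hJ, hx⟩))
    have hV : ∀ I < N - 1, ∀ J < N, listSpan (D.vEdgeVecs ord I J) ≤ T := fun I hI J hJ =>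
      listSpan_le.mpr fun x hx => mem_listSpan ((D.mem_basisVecs ord).mpr
        (Or.inr (Or.inl ⟨I, hI, J, hJ, hx⟩)))
    have hH : ∀ I < N, ∀ J < N - 1, listSpan (D.hEdgeVecs ord I J) ≤ T := fun I hI J hJ =>
      listSpan_le.mpr fun x hx => mem_listSpan ((D.mem_basisVecs ord).mpr
        (Or.inr (Or.inr (Or.inl ⟨I, hI, J, hJ, hx⟩))))
    have hX : ∀ I < N - 1, ∀ J < N - 1, listSpan (D.vertexVecs ord I J) ≤ T := fun I hI J hJ =>
      listSpan_le.mpr fun x hx => mem_listSpan ((D.mem_basisVecs ord).mpr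
        (Or.inr (Or.inr (Or.inr ⟨I, hI, J, hJ, hx⟩))))
    have h1 := p.1.isLt
    have h2 := p.2.isLt
    rcases grid_index_cases (N := N) hr (Nat.succ_pos p.1) (by omega) with
      ⟨I, hI, ha⟩ | ⟨I, hI, ha⟩ <;>
    rcases grid_index_cases (N := N) hr (Nat.succ_pos p.2) (by omega) with
      ⟨J, hJ, hb⟩ | ⟨J, hJ, hb⟩
    · refine hE I hI J hJ ?_
      rw [elemVecs, listSpan_mgs hA]
      exact D.kerVec_mem_group ord hord hp ⟨ha, hb⟩
    · refine D.kerVec_mem_of_orth ord hA hord hp ⟨ha, hb⟩ ?_ (hH I hI J hJ)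
      rw [listSpan_append]
      exact sup_le (hE _ hI _ (by omega)) (hE _ hI _ (by omega))
    · refine D.kerVec_mem_of_orth ord hA hord hp ⟨ha, hb⟩ ?_ (hV I hI J hJ)
      rw [listSpan_append]
      exact sup_le (hE _ (by omega) _ hJ) (hE _ (by omega) _ hJ)
    · refine D.kerVec_mem_of_orth ord hA hord hp ⟨ha, hb⟩ ?_ (hX I hI J hJ)
      have hI' : I < N := by omega
      have hJ' : J < N := by omega
      have hI1 : I + 1 < N := by omega
      have hJ1 : J + 1 < N := by omega
      simp only [listSpan_append, sup_le_iff]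
      exact ⟨⟨⟨⟨⟨⟨⟨hE _ hI' _ hJ', hE _ hI1 _ hJ'⟩, hE _ hI' _ hJ1⟩, hE _ hI1 _ hJ1⟩,
        hV _ hI _ hJ'⟩, hV _ hI _ hJ1⟩, hH _ hI' _ hJ⟩, hH _ hI1 _ hJ⟩

/-! ### Counting the columns of `K` -/

open Classical in
lemma length_group (hnd : ord.Nodup) (hord : ∀ p, p ∈ ord) (P Q : ℕ → Prop) :
    (D.group ord fun a b => P a ∧ Q b).length =
      ∑ p : Node N r with ¬ D.IsDual p,
        (if P (p.1 + 1) then 1 else 0) * (if Q (p.2 + 1) then 1 else 0) := by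
  have h : ∀ p : Node N r, (if P (p.1 + 1) then 1 else 0) * (if Q (p.2 + 1) then 1 else 0) =
      if P (p.1 + 1) ∧ Q (p.2 + 1) then 1 else 0 := by
    intro p
    by_cases h1 : P (p.1 + 1) <;> by_cases h2 : Q (p.2 + 1) <;> simp [h1, h2]
  simp only [h]
  rw [← Finset.card_filter, Finset.filter_filter, group, List.length_map,
    ← List.toFinset_card_of_nodup (hnd.filter _)]
  congr 1
  ext p
  simp [hord p, and_comm]

lemma length_flatMap_range {α : Type} (n : ℕ) (g : ℕ → List α) :
    ((List.range n).flatMap g).length = ∑ i ∈ Finset.range n, (g i).length := by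
  rw [List.length_flatMap]
  rfl

open Classical in
-- The residue `a % r` decides which of the two kinds can occur, and within each kind `a` determines
-- `I`.
lemma sum_grid_index_le_one (hr : 0 < r) (a : ℕ) :
    (∑ I ∈ Finset.range N, if I * r < a ∧ a < (I + 1) * r then 1 else 0) +
      (∑ I ∈ Finset.range (N - 1), if a = (I + 1) * r then 1 else 0) ≤ 1 := by
  have hdiv : ∀ I, I * r < a ∧ a < (I + 1) * r → a % r ≠ 0 ∧ I = a / r := by
    rintro I ⟨h1, h2⟩
    have h3 : a / r = I := Nat.div_eq_of_lt_le h1.le h2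
    refine ⟨fun h => ?_, h3.symm⟩
    have := Nat.div_add_mod a r
    rw [h, h3, mul_comm] at this
    omega
  rw [← Finset.card_filter, ← Finset.card_filter]
  by_cases h : a % r = 0
  · rw [Finset.filter_false_of_mem fun I _ hI => (hdiv I hI).1 h, Finset.card_empty, zero_add,
      Finset.card_le_one]
    intro I hI J hJ
    have e : (I + 1) * r = (J + 1) * r :=
      (Finset.mem_filter.mp hI).2.symm.trans (Finset.mem_filter.mp hJ).2
    have := Nat.eq_of_mul_eq_mul_right hr e
    omega
  · rw [Finset.filter_false_of_mem (s := Finset.range (N - 1)) fun I _ hI => h (by rw [hI]; simp),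
      Finset.card_empty, add_zero, Finset.card_le_one]
    intro I hI J hJ
    exact (hdiv I (Finset.mem_filter.mp hI).2).2.trans (hdiv J (Finset.mem_filter.mp hJ).2).2.symm

open Classical in
lemma sum_length_group (hnd : ord.Nodup) (hord : ∀ p, p ∈ ord) (n m : ℕ) (P Q : ℕ → ℕ → Prop) :
    ∑ I ∈ Finset.range n, ∑ J ∈ Finset.range m, (D.group ord fun a b => P I a ∧ Q J b).length =
      ∑ p : Node N r with ¬ D.IsDual p,
        (∑ I ∈ Finset.range n, if P I (p.1 + 1) then 1 else 0) *
          ∑ J ∈ Finset.range m, if Q J (p.2 + 1) then 1 else 0 := by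
  simp only [D.length_group ord hnd hord, Finset.sum_mul_sum]
  rw [Finset.sum_comm (s := Finset.univ.filter _)]
  exact Finset.sum_congr rfl fun I _ => Finset.sum_comm

/-- The contributions of a vertex to the four groups factor as `(a + b)(c + d)` over the two
coordinates, and each factor is at most one. An upper bound suffices: compared with the dimension of
the span it forces independence. -/
theorem length_basisVecs_le (hr : 0 < r) (hnd : ord.Nodup) (hord : ∀ p, p ∈ ord) :
    (D.basisVecs ord).length ≤ Nat.card {p : Node N r // ¬ D.IsDual p} := by
  classical
  simp only [basisVecs, List.length_append, length_flatMap_range, elemVecs, vEdgeVecs, hEdgeVecs,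
    vertexVecs, length_mgs, List.length_map]
  let P : ℕ → ℕ → Prop := fun I a => I * r < a ∧ a < (I + 1) * r
  let Q : ℕ → ℕ → Prop := fun I a => a = (I + 1) * r
  have h₁ := D.sum_length_group ord hnd hord N N P P
  have h₂ := D.sum_length_group ord hnd hord (N - 1) N Q P
  have h₃ := D.sum_length_group ord hnd hord N (N - 1) P Q
  have h₄ := D.sum_length_group ord hnd hord (N - 1) (N - 1) Q Q
  rw [h₁, h₂, h₃, h₄, ← Finset.sum_add_distrib, ← Finset.sum_add_distrib,
    ← Finset.sum_add_distrib, Nat.card_eq_fintype_card, Fintype.card_subtype,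
    Finset.card_eq_sum_ones]
  refine Finset.sum_le_sum fun p _ => ?_
  have := Nat.mul_le_mul (sum_grid_index_le_one (N := N) hr (p.1 + 1))
    (sum_grid_index_le_one (N := N) hr (p.2 + 1))
  have hexp : ∀ a b c d : ℕ, a * c + b * c + a * d + b * d = (a + b) * (c + d) := by
    intros
    ring
  rw [hexp]
  refine le_of_eq_of_le ?_ this
  congr!

end DualNodes

/-! ### Hat functions -/

section Tent

/-- The one-dimensional hat function of mesh size `h` centred at `m h`. -/
def tent (h : ℝ) (m : ℕ) (t : ℝ) : ℝ := max 0 (1 - |t / h - m|)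

variable {h : ℝ} {m : ℕ} {t : ℝ}

lemma continuous_tent : Continuous (tent h m) := by
  unfold tent
  fun_prop

lemma tent_nonneg : 0 ≤ tent h m t := le_max_left _ _

lemma tent_le_one : tent h m t ≤ 1 := max_le zero_le_one (by linarith [abs_nonneg (t / h - m)])

lemma tent_eq_zero (ht : 1 ≤ |t / h - m|) : tent h m t = 0 := max_eq_left (by linarith)

lemma tent_natCast_mul (hh : 0 < h) (n : ℕ) : tent h m (n * h) = if n = m then 1 else 0 := by
  rw [tent, mul_div_assoc, div_self hh.ne', mul_one]
  split_ifs with hnm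
  · simp [hnm]
  · refine max_eq_left ?_
    have : (1 : ℝ) ≤ |(n : ℝ) - m| := by
      have h1 : (1 : ℤ) ≤ |(n : ℤ) - m| := Int.one_le_abs (sub_ne_zero.mpr (by exact_mod_cast hnm))
      exact_mod_cast h1
    linarith

lemma abs_tent_sub_le (hh : 0 < h) (s t : ℝ) : |tent h m s - tent h m t| ≤ h⁻¹ * |s - t| := by
  have h1 : |tent h m s - tent h m t| ≤ |(1 - |s / h - m|) - (1 - |t / h - m|)| := by
    simpa [tent] using abs_max_sub_max_le_max 0 (1 - |s / h - m|) 0 (1 - |t / h - m|)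
  refine h1.trans ?_
  have h2 : (1 - |s / h - m|) - (1 - |t / h - m|) = |t / h - m| - |s / h - m| := by ring
  rw [h2]
  refine (abs_abs_sub_abs_le_abs_sub _ _).trans (le_of_eq ?_)
  have h3 : t / h - m - (s / h - m) = h⁻¹ * (t - s) := by field_simp; ring
  rw [h3, abs_mul, abs_of_pos (inv_pos.mpr hh), abs_sub_comm]

/-- The Lipschitz constant also covers the kinks, where `deriv` takes its default value `0`. -/
lemma abs_deriv_tent_le (hh : 0 < h) (t : ℝ) : |deriv (tent h m) t| ≤ h⁻¹ := by
  have hL : LipschitzWith ⟨h⁻¹, (inv_pos.mpr hh).le⟩ (tent h m) :=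
    LipschitzWith.of_dist_le_mul fun s t => by
      rw [Real.dist_eq, Real.dist_eq]
      exact abs_tent_sub_le hh s t
  exact norm_deriv_le_of_lipschitz (x₀ := t) hL

lemma deriv_tent_eq_zero (ht : 1 < |t / h - m|) : deriv (tent h m) t = 0 := by
  have hev : tent h m =ᶠ[nhds t] fun _ => 0 := by
    have hc : Continuous fun s : ℝ => |s / h - m| := by fun_prop
    filter_upwards [hc.continuousAt.eventually (lt_mem_nhds ht)] with s hs
    exact tent_eq_zero hs.le
  rw [hev.deriv_eq]
  simp

/-- The grid lines of mesh size `h`. -/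
def gridPts (h : ℝ) : Set ℝ := Set.range fun n : ℤ => n * h

lemma countable_gridPts (h : ℝ) : (gridPts h).Countable := Set.countable_range _

lemma div_ne_of_notMem_gridPts (hh : 0 < h) (ht : t ∉ gridPts h) (n : ℤ) : t / h ≠ n := by
  intro e
  exact ht ⟨n, by simp only [← e]; field_simp⟩

/-- The only kinks are at `(m-1)h`, `m h` and `(m+1)h`, all of them grid points. -/
lemma differentiableAt_tent (hh : 0 < h) (ht : t ∉ gridPts h) :
    DifferentiableAt ℝ (tent h m) t := by
  have hd : DifferentiableAt ℝ (fun s : ℝ => 1 - |s / h - m|) t := by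
    refine DifferentiableAt.const_sub ?_ 1
    refine DifferentiableAt.abs (by fun_prop) ?_
    exact sub_ne_zero.mpr (by exact_mod_cast div_ne_of_notMem_gridPts hh ht m)
  have hne : (1 - |t / h - m|) ≠ 0 := by
    intro e
    have : |t / h - m| = 1 := by linarith
    rcases (abs_eq zero_le_one).mp this with e | e
    · exact div_ne_of_notMem_gridPts hh ht (m + 1) (by push_cast; linarith)
    · exact div_ne_of_notMem_gridPts hh ht (m - 1) (by push_cast; linarith)
  rcases hne.lt_or_gt with hlt | hgt
  · refine (differentiableAt_const (0 : ℝ)).congr_of_eventuallyEq ?_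
    filter_upwards [hd.continuousAt.eventually (gt_mem_nhds hlt)] with s hs
    exact max_eq_left hs.le
  · refine hd.congr_of_eventuallyEq ?_
    filter_upwards [hd.continuousAt.eventually (lt_mem_nhds hgt)] with s hs
    exact max_eq_right hs.le

lemma tent_affine (hh : 0 < h) (n : ℕ) : ∃ α β : ℝ, ∀ t ∈ Set.Icc (n * h) ((n + 1) * h),
    tent h m t = α + β * t := by
  have key : ∀ t ∈ Set.Icc (n * h) ((n + 1) * h), (n : ℝ) ≤ t / h ∧ t / h ≤ n + 1 := fun t ht =>
    ⟨(le_div_iff₀ hh).mpr ht.1, (div_le_iff₀ hh).mpr ht.2⟩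
  rcases lt_trichotomy (n + 1) m with hlt | heq | hgt
  · refine ⟨0, 0, fun t ht => ?_⟩
    have hm : (n : ℝ) + 2 ≤ m := by exact_mod_cast hlt
    rw [tent_eq_zero]
    · simp
    · rw [abs_of_nonpos] <;> linarith [(key t ht).2]
  · refine ⟨1 - m, h⁻¹, fun t ht => ?_⟩
    have hm : (n : ℝ) + 1 = m := by exact_mod_cast heq
    obtain ⟨h1, h2⟩ := key t ht
    rw [tent, abs_of_nonpos (by linarith), max_eq_right (by linarith)]
    field_simp
    ring
  · rcases Nat.lt_or_ge m n with hmn | hmn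
    · refine ⟨0, 0, fun t ht => ?_⟩
      have hm : (m : ℝ) + 1 ≤ n := by exact_mod_cast hmn
      rw [tent_eq_zero]
      · simp
      · rw [abs_of_nonneg] <;> linarith [(key t ht).1]
    · have hm : (n : ℝ) = m := by exact_mod_cast (by omega : n = m)
      refine ⟨1 + m, -h⁻¹, fun t ht => ?_⟩
      obtain ⟨h1, h2⟩ := key t ht
      rw [tent, abs_of_nonneg (by linarith), max_eq_right (by linarith)]
      field_simp
      ring

end Tent

/-! ### Nodal representation of `V_h` -/

section FiniteElements

variable {N r : ℕ}

lemma meshh_pos (hN : 0 < N) (hr : 0 < r) : 0 < meshh N r := by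
  unfold meshh
  positivity

lemma mul_meshh (hN : 0 < N) (hr : 0 < r) : ((N * r : ℕ) : ℝ) * meshh N r = 1 := by
  unfold meshh
  push_cast
  field_simp

lemma meshH_eq (hr : 0 < r) : meshH N = r * meshh N r := by
  unfold meshH meshh
  rcases Nat.eq_zero_or_pos N with rfl | hN
  · simp
  · field_simp

lemma hat_apply (p : Node N r) (x : ℝ × ℝ) :
    hat p x = tent (meshh N r) (p.1 + 1) x.1 * tent (meshh N r) (p.2 + 1) x.2 := by
  simp [hat, tent]

lemma continuous_hat (p : Node N r) : Continuous (hat p) := by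
  unfold hat
  fun_prop

lemma hat_coord (hN : 0 < N) (hr : 0 < r) (p q : Node N r) :
    hat p (coord q) = if q = p then 1 else 0 := by
  have h1 := tent_natCast_mul (m := p.1 + 1) (meshh_pos hN hr) (q.1 + 1)
  have h2 := tent_natCast_mul (m := p.2 + 1) (meshh_pos hN hr) (q.2 + 1)
  push_cast at h1 h2
  rw [hat_apply, coord]
  simp only [h1, h2]
  by_cases e1 : q.1 = p.1 <;> by_cases e2 : q.2 = p.2 <;>
    simp [Prod.ext_iff, e1, e2] <;> omega

lemma hat_eq_zero_of_notMem (hN : 0 < N) (hr : 0 < r) (p : Node N r) {x : ℝ × ℝ}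
    (hx : x ∉ unitSq) : hat p x = 0 := by
  have hh := meshh_pos hN hr
  have key : ∀ (i : Fin (N * r - 1)) (t : ℝ), t ∉ Set.Ioo (0 : ℝ) 1 →
      tent (meshh N r) (i + 1) t = 0 := by
    intro i t ht
    apply tent_eq_zero
    rw [Set.mem_Ioo, not_and_or, not_lt, not_lt] at ht
    have hi := i.isLt
    push_cast
    rcases ht with ht | ht
    · have : t / meshh N r ≤ 0 := div_nonpos_of_nonpos_of_nonneg ht hh.le
      rw [abs_of_nonpos] <;> linarith [(Nat.cast_nonneg (i : ℕ) : (0 : ℝ) ≤ (i : ℕ))]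
    · have h1 : ((N * r : ℕ) : ℝ) ≤ t / meshh N r := by
        rw [le_div_iff₀ hh, mul_meshh hN hr]
        exact ht
      have h2 : (((i : ℕ) : ℝ) + 1) + 1 ≤ ((N * r : ℕ) : ℝ) := by
        exact_mod_cast (by omega : (i : ℕ) + 1 + 1 ≤ N * r)
      rw [abs_of_nonneg] <;> linarith
  rw [hat_apply]
  rw [unitSq, Set.mem_prod, not_and_or] at hx
  rcases hx with hx | hx
  · rw [key _ _ hx, zero_mul]
  · rw [key p.2 _ hx, mul_zero]

lemma hat_mem_Vh (hN : 0 < N) (hr : 0 < r) (p : Node N r) : hat p ∈ Vh N r := by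
  refine ⟨continuous_hat p, fun x hx => hat_eq_zero_of_notMem hN hr p hx, fun a b _ _ => ?_⟩
  obtain ⟨α, β, h1⟩ := tent_affine (m := p.1 + 1) (meshh_pos hN hr) a
  obtain ⟨γ, δ, h2⟩ := tent_affine (m := p.2 + 1) (meshh_pos hN hr) b
  refine ⟨α * γ, β * γ, α * δ, β * δ, fun x hx => ?_⟩
  rw [hat_apply, h1 _ hx.1, h2 _ hx.2]
  ring

lemma ofCoeffs_mem_Vh (hN : 0 < N) (hr : 0 < r) (c : Node N r → ℝ) : ofCoeffs c ∈ Vh N r :=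
  Submodule.sum_mem _ fun p _ => Submodule.smul_mem _ _ (hat_mem_Vh hN hr p)

lemma coeffs_ofCoeffs (hN : 0 < N) (hr : 0 < r) (c : Node N r → ℝ) :
    coeffs (ofCoeffs c) = c := by
  ext q
  simp [coeffs, ofCoeffs, hat_coord hN hr]

/-- A finite element function that vanishes at the interior vertices vanishes. -/
lemma eq_zero_of_coeffs_eq_zero (hN : 0 < N) (hr : 0 < r) {v : ℝ × ℝ → ℝ} (hv : v ∈ Vh N r)
    (h0 : (coeffs v : Node N r → ℝ) = 0) : v = 0 := by
  obtain ⟨-, hout, hbil⟩ := hv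
  have hh := meshh_pos hN hr
  have h1 := mul_meshh hN hr
  set h := meshh N r with hdef
  -- Grid points on the boundary are outside the open square, where `v` vanishes; the others are
  -- interior vertices, with index shifted by one.
  have hcorner : ∀ i j : ℕ, i ≤ N * r → j ≤ N * r → v (i * h, j * h) = 0 := by
    intro i j hi hj
    by_cases hint : (0 < i ∧ i < N * r) ∧ (0 < j ∧ j < N * r)
    · obtain ⟨⟨hi0, hi1⟩, hj0, hj1⟩ := hint
      have := congrFun h0 (⟨i - 1, by omega⟩, ⟨j - 1, by omega⟩)
      simp only [coeffs, coord, Pi.zero_apply, ← hdef] at this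
      rwa [Nat.cast_sub hi0, Nat.cast_sub hj0, Nat.cast_one, sub_add_cancel, sub_add_cancel] at this
    · refine hout _ fun hmem => hint ?_
      have aux : ∀ n : ℕ, (n : ℝ) * h ∈ Set.Ioo (0 : ℝ) 1 → 0 < n ∧ n < N * r := by
        rintro n ⟨hn0, hn1⟩
        have a1 : (0 : ℝ) < n := (pos_iff_pos_of_mul_pos hn0).mpr hh
        have a2 : (n : ℝ) < (N * r : ℕ) := by
          rw [← h1] at hn1
          exact lt_of_mul_lt_mul_right hn1 hh.le
        exact ⟨by exact_mod_cast a1, by exact_mod_cast a2⟩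
      exact ⟨aux i hmem.1, aux j hmem.2⟩
  funext x
  by_cases hx : x ∈ unitSq
  swap
  · exact hout x hx
  have hcell : ∀ t ∈ Set.Ioo (0 : ℝ) 1, ∃ a < N * r, t ∈ Set.Icc ((a : ℝ) * h) ((a + 1) * h) := by
    rintro t ⟨ht0, ht1⟩
    have hp : 0 ≤ t / h := by positivity
    refine ⟨⌊t / h⌋₊, ?_, ?_, ?_⟩
    · rw [Nat.floor_lt hp, div_lt_iff₀ hh, h1]
      exact ht1
    · rw [← le_div_iff₀ hh]
      exact Nat.floor_le hp
    · rw [← div_le_iff₀ hh]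
      exact (Nat.lt_floor_add_one _).le
  obtain ⟨a, ha, hxa⟩ := hcell x.1 hx.1
  obtain ⟨b, hb, hxb⟩ := hcell x.2 hx.2
  obtain ⟨c₀, c₁, c₂, c₃, hc⟩ := hbil a b ha hb
  have ha' : (a : ℝ) * h ≤ (a + 1) * h := by nlinarith
  have hb' : (b : ℝ) * h ≤ (b + 1) * h := by nlinarith
  have e00 := hc (a * h, b * h) ⟨⟨le_rfl, ha'⟩, ⟨le_rfl, hb'⟩⟩
  have e10 := hc ((a + 1) * h, b * h) ⟨⟨ha', le_rfl⟩, ⟨le_rfl, hb'⟩⟩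
  have e01 := hc (a * h, (b + 1) * h) ⟨⟨le_rfl, ha'⟩, ⟨hb', le_rfl⟩⟩
  have e11 := hc ((a + 1) * h, (b + 1) * h) ⟨⟨ha', le_rfl⟩, ⟨hb', le_rfl⟩⟩
  have z00 := hcorner a b ha.le hb.le
  have z10 := hcorner (a + 1) b ha hb.le
  have z01 := hcorner a (b + 1) ha.le hb
  have z11 := hcorner (a + 1) (b + 1) ha hb
  push_cast at z10 z01 z11
  rw [z00] at e00
  rw [z10] at e10
  rw [z01] at e01
  rw [z11] at e11
  simp only at e00 e10 e01 e11
  -- The mixed second difference of the corner values isolates `c₃ h²`; first differences then give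
  -- `c₁` and `c₂`.
  have hc3 : c₃ = 0 := by
    have : c₃ * (h * h) = 0 := by linear_combination e10 + e01 - e00 - e11
    exact (mul_eq_zero.mp this).resolve_right (by positivity)
  subst hc3
  have hc1 : c₁ = 0 := by
    have : c₁ * h = 0 := by linear_combination e00 - e10
    exact (mul_eq_zero.mp this).resolve_right hh.ne'
  have hc2 : c₂ = 0 := by
    have : c₂ * h = 0 := by linear_combination e00 - e01
    exact (mul_eq_zero.mp this).resolve_right hh.ne'
  subst hc1 hc2
  rw [hc x ⟨hxa, hxb⟩, Pi.zero_apply]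
  linear_combination -e00

lemma ofCoeffs_coeffs (hN : 0 < N) (hr : 0 < r) {v : ℝ × ℝ → ℝ} (hv : v ∈ Vh N r) :
    ofCoeffs (coeffs v : Node N r → ℝ) = v := by
  refine (sub_eq_zero.mp (eq_zero_of_coeffs_eq_zero hN hr
    (sub_mem hv (ofCoeffs_mem_Vh hN hr (coeffs v))) ?_)).symm
  have := coeffs_ofCoeffs hN hr (coeffs v : Node N r → ℝ)
  ext p
  have := congrFun this p
  simp only [coeffs, Pi.sub_apply, Pi.zero_apply] at this ⊢
  rw [this, sub_self]

end FiniteElements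

/-! ### The energy form on the finite element space -/

section Energy

variable {N r : ℕ}

lemma ae_notMem_gridPts (h : ℝ) : ∀ᵐ x : ℝ × ℝ, x.1 ∉ gridPts h ∧ x.2 ∉ gridPts h := by
  have hG : ∀ᵐ t : ℝ, t ∉ gridPts h := (countable_gridPts h).ae_notMem volume
  rw [Measure.volume_eq_prod]
  exact (Measure.quasiMeasurePreserving_fst.ae hG).and (Measure.quasiMeasurePreserving_snd.ae hG)

lemma measurableSet_unitSq : MeasurableSet unitSq := measurableSet_Ioo.prod measurableSet_Ioo

lemma volume_unitSq : volume unitSq = 1 := by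
  rw [unitSq, Measure.volume_eq_prod, Measure.prod_prod]
  simp

lemma dx_hat (p : Node N r) (x : ℝ × ℝ) :
    dx (hat p) x = deriv (tent (meshh N r) (p.1 + 1)) x.1 * tent (meshh N r) (p.2 + 1) x.2 := by
  simp only [dx, hat_apply]
  rw [deriv_mul_const_field]

lemma dy_hat (p : Node N r) (x : ℝ × ℝ) :
    dy (hat p) x = tent (meshh N r) (p.1 + 1) x.1 * deriv (tent (meshh N r) (p.2 + 1)) x.2 := by
  simp only [dy, hat_apply]
  rw [deriv_const_mul_field]

lemma measurable_dx_hat (p : Node N r) : Measurable (dx (hat p)) := by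
  have : dx (hat p) = fun x => _ := funext fun x => dx_hat p x
  rw [this]
  exact ((measurable_deriv _).comp measurable_fst).mul
    (continuous_tent.measurable.comp measurable_snd)

lemma measurable_dy_hat (p : Node N r) : Measurable (dy (hat p)) := by
  have : dy (hat p) = fun x => _ := funext fun x => dy_hat p x
  rw [this]
  exact (continuous_tent.measurable.comp measurable_fst).mul
    ((measurable_deriv _).comp measurable_snd)

lemma abs_dx_hat_le (hN : 0 < N) (hr : 0 < r) (p : Node N r) (x : ℝ × ℝ) :
    |dx (hat p) x| ≤ (meshh N r)⁻¹ := by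
  have hh := meshh_pos hN hr
  rw [dx_hat, abs_mul, abs_of_nonneg (tent_nonneg (t := x.2))]
  exact (mul_le_of_le_one_right (abs_nonneg _) tent_le_one).trans (abs_deriv_tent_le hh _)

lemma abs_dy_hat_le (hN : 0 < N) (hr : 0 < r) (p : Node N r) (x : ℝ × ℝ) :
    |dy (hat p) x| ≤ (meshh N r)⁻¹ := by
  have hh := meshh_pos hN hr
  rw [dy_hat, abs_mul, abs_of_nonneg (tent_nonneg (t := x.1))]
  exact (mul_le_of_le_one_left (abs_nonneg _) tent_le_one).trans (abs_deriv_tent_le hh _)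

lemma dx_ofCoeffs (hN : 0 < N) (hr : 0 < r) (c : Node N r → ℝ) {x : ℝ × ℝ}
    (hx : x.1 ∉ gridPts (meshh N r)) : dx (ofCoeffs c) x = ∑ p, c p * dx (hat p) x := by
  have hd : ∀ p : Node N r, HasDerivAt (fun t => hat p (t, x.2)) (dx (hat p) x) x.1 := by
    intro p
    rw [dx_hat]
    simp only [hat_apply]
    exact (differentiableAt_tent (meshh_pos hN hr) hx).hasDerivAt.mul_const _
  have := HasDerivAt.fun_sum (u := Finset.univ) fun p _ => (hd p).const_mul (c p)
  rw [dx, ← this.deriv]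
  congr 1
  ext t
  simp [ofCoeffs]

lemma hasDerivAt_snd_ofCoeffs (hN : 0 < N) (hr : 0 < r) (c : Node N r → ℝ) (x : ℝ) {y : ℝ}
    (hy : y ∉ gridPts (meshh N r)) :
    HasDerivAt (fun t => ofCoeffs c (x, t)) (∑ p, c p * dy (hat p) (x, y)) y := by
  have hd : ∀ p : Node N r, HasDerivAt (fun t => hat p (x, t)) (dy (hat p) (x, y)) y := by
    intro p
    rw [dy_hat]
    simp only [hat_apply]
    exact (differentiableAt_tent (meshh_pos hN hr) hy).hasDerivAt.const_mul _
  have := HasDerivAt.fun_sum (u := Finset.univ) fun p _ => (hd p).const_mul (c p)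
  have e : (fun t => ofCoeffs c (x, t)) = fun t => ∑ p, c p * hat p (x, t) := by
    ext t
    simp [ofCoeffs]
  rw [e]
  exact this

lemma dy_ofCoeffs (hN : 0 < N) (hr : 0 < r) (c : Node N r → ℝ) {x : ℝ × ℝ}
    (hx : x.2 ∉ gridPts (meshh N r)) : dy (ofCoeffs c) x = ∑ p, c p * dy (hat p) x :=
  (hasDerivAt_snd_ofCoeffs hN hr c x.1 hx).deriv

/-- Coefficients that are measurable and bounded between `1` and `β` on the unit square. -/
structure IsCoefficient (κ : ℝ × ℝ → ℝ) (β : ℝ) : Prop where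
  measurable : Measurable κ
  one_le : ∀ x ∈ unitSq, 1 ≤ κ x
  le_beta : ∀ x ∈ unitSq, κ x ≤ β

variable {κ : ℝ × ℝ → ℝ} {β : ℝ}

/-- Bounds on `κ` hold only in the open square, while closed coarse elements may touch its boundary;
therefore the inclusion is required only almost everywhere. -/
lemma IsCoefficient.integrableOn_mul (hκ : IsCoefficient κ β) {S : Set (ℝ × ℝ)}
    (hS : ∀ᵐ x ∂volume.restrict S, x ∈ unitSq) (hS' : volume S ≠ ⊤) {g : ℝ × ℝ → ℝ}
    (hg : Measurable g) {C : ℝ} (hC : ∀ x, |g x| ≤ C) :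
    IntegrableOn (fun x => κ x * g x) S := by
  refine Measure.integrableOn_of_bounded (M := β * C) hS'
    (hκ.measurable.mul hg).aestronglyMeasurable ?_
  filter_upwards [hS] with x hx
  have h1 := hκ.one_le x hx
  have h2 := hκ.le_beta x hx
  rw [Real.norm_eq_abs, abs_mul, abs_of_nonneg (by linarith)]
  exact mul_le_mul h2 (hC x) (abs_nonneg _) (by linarith)

lemma ae_mem_unitSq : ∀ᵐ x ∂volume.restrict unitSq, x ∈ unitSq :=
  ae_restrict_mem measurableSet_unitSq

lemma IsCoefficient.integrableOn_hat (hN : 0 < N) (hr : 0 < r) (hκ : IsCoefficient κ β)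
    (p q : Node N r) : IntegrableOn (fun x => κ x * (dx (hat p) x * dx (hat q) x +
      dy (hat p) x * dy (hat q) x)) unitSq := by
  have hh := meshh_pos hN hr
  refine hκ.integrableOn_mul ae_mem_unitSq (by simp [volume_unitSq])
    (((measurable_dx_hat p).mul (measurable_dx_hat q)).add
      ((measurable_dy_hat p).mul (measurable_dy_hat q)))
    (C := (meshh N r)⁻¹ * (meshh N r)⁻¹ + (meshh N r)⁻¹ * (meshh N r)⁻¹) fun x => ?_
  refine (abs_add_le _ _).trans ?_
  simp only [abs_mul]
  have := abs_dx_hat_le hN hr p x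
  have := abs_dx_hat_le hN hr q x
  have := abs_dy_hat_le hN hr p x
  have := abs_dy_hat_le hN hr q x
  gcongr

/-- This identity moves all algebra with `a` to the stiffness matrix. `deriv` is expanded linearly
only off the grid lines, where the hats are differentiable, and these lines form a null set. -/
lemma energy_ofCoeffs (hN : 0 < N) (hr : 0 < r) (hκ : IsCoefficient κ β) (c d : Node N r → ℝ) :
    energy κ (ofCoeffs c) (ofCoeffs d) = c ⬝ᵥ (stiffness N r κ *ᵥ d) := by
  have h1 : energy κ (ofCoeffs c) (ofCoeffs d) = ∫ x in unitSq, ∑ p : Node N r, ∑ q : Node N r,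
      (c p * d q) * (κ x * (dx (hat p) x * dx (hat q) x + dy (hat p) x * dy (hat q) x)) := by
    refine integral_congr_ae ?_
    filter_upwards [ae_restrict_of_ae (ae_notMem_gridPts (meshh N r))] with x hx
    rw [dx_ofCoeffs hN hr c hx.1, dx_ofCoeffs hN hr d hx.1, dy_ofCoeffs hN hr c hx.2,
      dy_ofCoeffs hN hr d hx.2, Finset.sum_mul_sum, Finset.sum_mul_sum, ← Finset.sum_add_distrib,
      Finset.mul_sum]
    refine Finset.sum_congr rfl fun p _ => ?_
    rw [← Finset.sum_add_distrib, Finset.mul_sum]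
    refine Finset.sum_congr rfl fun q _ => ?_
    ring
  rw [h1, integral_finsetSum _ fun p _ => integrable_finsetSum _ fun q _ =>
    (hκ.integrableOn_hat hN hr p q).const_mul _]
  simp only [dotProduct, mulVec, Finset.mul_sum]
  refine Finset.sum_congr rfl fun p _ => ?_
  rw [integral_finsetSum _ fun q _ => (hκ.integrableOn_hat hN hr p q).const_mul _]
  refine Finset.sum_congr rfl fun q _ => ?_
  rw [integral_const_mul]
  simp only [stiffness, energy, energyOn, Matrix.of_apply]
  ring

lemma energy_eq_form (hN : 0 < N) (hr : 0 < r) (hκ : IsCoefficient κ β) {u v : ℝ × ℝ → ℝ}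
    (hu : u ∈ Vh N r) (hv : v ∈ Vh N r) :
    energy κ u v = coeffs u ⬝ᵥ (stiffness N r κ *ᵥ coeffs v) := by
  rw [← energy_ofCoeffs hN hr hκ, ofCoeffs_coeffs hN hr hu, ofCoeffs_coeffs hN hr hv]

/-! ### The Friedrichs inequality -/

/-- A one-dimensional Cauchy–Schwarz inequality. -/
lemma sq_setIntegral_le {g : ℝ → ℝ} (hg : Measurable g) {C : ℝ} (hC : ∀ t, |g t| ≤ C) {y : ℝ}
    (hy : y ∈ Set.Ioo (0 : ℝ) 1) :
    (∫ t in (0 : ℝ)..y, g t) ^ 2 ≤ ∫ t in Set.Ioo (0 : ℝ) 1, g t ^ 2 := by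
  have hi : ∀ S : Set ℝ, volume S ≠ ⊤ → IntegrableOn g S := fun S hS =>
    Measure.integrableOn_of_bounded (M := C) hS hg.aestronglyMeasurable
      (Filter.Eventually.of_forall hC)
  have hi2 : ∀ S : Set ℝ, volume S ≠ ⊤ → IntegrableOn (fun t => g t ^ 2) S := fun S hS =>
    Measure.integrableOn_of_bounded (M := C ^ 2) hS (hg.pow_const 2).aestronglyMeasurable
      (Filter.Eventually.of_forall fun t => by
        rw [Real.norm_eq_abs, abs_pow]
        exact pow_le_pow_left₀ (abs_nonneg _) (hC t) 2)
  rw [intervalIntegral.integral_of_le hy.1.le, integral_Ioc_eq_integral_Ioo]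
  set m := ∫ t in Set.Ioo 0 y, g t with hm
  have hfin : volume (Set.Ioo 0 y) ≠ ⊤ := by simp
  -- Expanding `∫ (g - m)²` over `(0, y)` with `m = ∫ g` gives `∫ g² ≥ m² (2 - y) ≥ m²`, since `y <
  -- 1`.
  have h0 : 0 ≤ ∫ t in Set.Ioo 0 y, (g t - m) ^ 2 := integral_nonneg fun t => sq_nonneg _
  have h1 : ∫ t in Set.Ioo 0 y, (g t - m) ^ 2 =
      (∫ t in Set.Ioo 0 y, g t ^ 2) - 2 * m * m + m ^ 2 * y := by
    have e : ∀ t, (g t - m) ^ 2 = (g t ^ 2 - 2 * m * g t) + m ^ 2 := fun t => by ring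
    simp only [e]
    have hs : IntegrableOn (fun t => g t ^ 2 - 2 * m * g t) (Set.Ioo 0 y) :=
      (hi2 _ hfin).sub ((hi _ hfin).const_mul _)
    rw [integral_add hs (integrable_const _),
      integral_sub (hi2 _ hfin) ((hi _ hfin).const_mul _), integral_const_mul, ← hm]
    simp [hy.1.le]
    ring
  have h2 : ∫ t in Set.Ioo 0 y, g t ^ 2 ≤ ∫ t in Set.Ioo (0 : ℝ) 1, g t ^ 2 :=
    setIntegral_mono_set (hi2 _ (by simp)) (Filter.Eventually.of_forall fun t => sq_nonneg _)
      (Set.Ioo_subset_Ioo_right hy.2.le).eventuallyLE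
  nlinarith [sq_nonneg m, hy.2]

lemma bounded_ofCoeffs (c : Node N r → ℝ) (x : ℝ × ℝ) : |ofCoeffs c x| ≤ ∑ p, |c p| := by
  simp only [ofCoeffs, Finset.sum_apply, Pi.smul_apply, smul_eq_mul]
  refine (Finset.abs_sum_le_sum_abs _ _).trans (Finset.sum_le_sum fun p _ => ?_)
  rw [abs_mul, hat_apply, abs_of_nonneg (mul_nonneg tent_nonneg tent_nonneg)]
  exact mul_le_of_le_one_right (abs_nonneg _) (mul_le_one₀ tent_le_one tent_nonneg tent_le_one)

lemma continuous_ofCoeffs (c : Node N r → ℝ) : Continuous (ofCoeffs c) := by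
  have e : ofCoeffs c = fun x => ∑ p, c p * hat p x := by
    ext x
    simp [ofCoeffs]
  rw [e]
  exact continuous_finsetSum _ fun p _ => continuous_const.mul (continuous_hat p)

/-- The Friedrichs inequality with constant `1`. -/
lemma friedrichs (hN : 0 < N) (hr : 0 < r) (hκ : IsCoefficient κ β) (c : Node N r → ℝ) :
    ∫ x in unitSq, ofCoeffs c x ^ 2 ≤ energy κ (ofCoeffs c) (ofCoeffs c) := by
  have hh := meshh_pos hN hr
  set g : ℝ × ℝ → ℝ := fun x => ∑ p, c p * dy (hat p) x with hg
  set k : ℝ × ℝ → ℝ := fun x => ∑ p, c p * dx (hat p) x with hk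
  have hgm : Measurable g :=
    Finset.measurable_fun_sum _ fun p _ => (measurable_dy_hat p).const_mul _
  have hkm : Measurable k :=
    Finset.measurable_fun_sum _ fun p _ => (measurable_dx_hat p).const_mul _
  set C := ∑ p, |c p| * (meshh N r)⁻¹ with hCdef
  have hgC : ∀ x, |g x| ≤ C := fun x =>
    (Finset.abs_sum_le_sum_abs _ _).trans (Finset.sum_le_sum fun p _ => by
      rw [abs_mul]; exact mul_le_mul_of_nonneg_left (abs_dy_hat_le hN hr p x) (abs_nonneg _))
  have hkC : ∀ x, |k x| ≤ C := fun x =>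
    (Finset.abs_sum_le_sum_abs _ _).trans (Finset.sum_le_sum fun p _ => by
      rw [abs_mul]; exact mul_le_mul_of_nonneg_left (abs_dx_hat_le hN hr p x) (abs_nonneg _))
  have hfin : volume unitSq ≠ ⊤ := by simp [volume_unitSq]
  have hsq : ∀ {w : ℝ × ℝ → ℝ} {B : ℝ}, Measurable w → (∀ x, |w x| ≤ B) →
      IntegrableOn (fun x => w x ^ 2) unitSq := fun {w B} hw hB =>
    Measure.integrableOn_of_bounded (M := B ^ 2) hfin (hw.pow_const 2).aestronglyMeasurable
      (Filter.Eventually.of_forall fun t => by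
        rw [Real.norm_eq_abs, abs_pow]
        exact pow_le_pow_left₀ (abs_nonneg _) (hB t) 2)
  have hu2 := hsq (continuous_ofCoeffs c).measurable (bounded_ofCoeffs c)
  have hg2 := hsq hgm hgC
  -- Only the vertical derivative is used: the function vanishes on the bottom side, so its value is
  -- the integral of that derivative along the vertical segment, and the estimate is then integrated
  -- over the unit square.
  have hpt : ∀ x y : ℝ, y ∈ Set.Ioo (0 : ℝ) 1 →
      ofCoeffs c (x, y) ^ 2 ≤ ∫ t in Set.Ioo (0 : ℝ) 1, g (x, t) ^ 2 := by
    intro x y hy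
    have hm : Measurable fun t => g (x, t) := hgm.comp measurable_prodMk_left
    have hftc : ∫ t in (0 : ℝ)..y, g (x, t) = ofCoeffs c (x, y) - ofCoeffs c (x, 0) := by
      refine integral_eq_of_hasDerivAt_off_countable_of_le (fun t => ofCoeffs c (x, t))
        (fun t => g (x, t)) hy.1.le
        (countable_gridPts (meshh N r)) ?_ ?_ ?_
      · exact ((continuous_ofCoeffs c).comp (by fun_prop)).continuousOn
      · exact fun t ht => hasDerivAt_snd_ofCoeffs hN hr c x ht.2
      · rw [intervalIntegrable_iff]
        exact Measure.integrableOn_of_bounded (M := C) (by simp) hm.aestronglyMeasurable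
          (Filter.Eventually.of_forall fun t => hgC _)
    have h0 : ofCoeffs c (x, 0) = 0 :=
      (ofCoeffs_mem_Vh hN hr c).2.1 _ fun hmem => lt_irrefl _ hmem.2.1
    rw [h0, sub_zero] at hftc
    rw [← hftc]
    exact sq_setIntegral_le hm (fun t => hgC _) hy
  have h1 : ∫ x in unitSq, ofCoeffs c x ^ 2 ≤ ∫ x in unitSq, g x ^ 2 := by
    rw [unitSq, Measure.volume_eq_prod, setIntegral_prod _ hu2, setIntegral_prod _ hg2]
    have hug : IntegrableOn (fun x => ∫ t in Set.Ioo (0 : ℝ) 1, g (x, t) ^ 2)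
        (Set.Ioo (0 : ℝ) 1) := by
      have := hg2
      rw [IntegrableOn, unitSq, Measure.volume_eq_prod, ← Measure.prod_restrict] at this
      exact this.integral_prod_left
    have huu : IntegrableOn (fun x => ∫ t in Set.Ioo (0 : ℝ) 1, ofCoeffs c (x, t) ^ 2)
        (Set.Ioo (0 : ℝ) 1) := by
      have := hu2
      rw [IntegrableOn, unitSq, Measure.volume_eq_prod, ← Measure.prod_restrict] at this
      exact this.integral_prod_left
    refine integral_mono huu hug fun x => ?_
    have hconst : ∫ t in Set.Ioo (0 : ℝ) 1, (∫ t in Set.Ioo (0 : ℝ) 1, g (x, t) ^ 2) =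
        ∫ t in Set.Ioo (0 : ℝ) 1, g (x, t) ^ 2 := by simp
    refine le_trans (setIntegral_mono_on ?_ (by simp) measurableSet_Ioo fun y hy => hpt x y hy)
      hconst.le
    refine Measure.integrableOn_of_bounded (M := (∑ p, |c p|) ^ 2) (by simp)
      (((continuous_ofCoeffs c).comp (by fun_prop)).pow 2).measurable.aestronglyMeasurable
      (Filter.Eventually.of_forall fun t => ?_)
    rw [Real.norm_eq_abs, abs_pow]
    exact pow_le_pow_left₀ (abs_nonneg _) (bounded_ofCoeffs c _) 2
  refine h1.trans ?_
  have h2 : energy κ (ofCoeffs c) (ofCoeffs c) =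
      ∫ x in unitSq, κ x * (k x ^ 2 + g x ^ 2) := by
    refine integral_congr_ae ?_
    filter_upwards [ae_restrict_of_ae (ae_notMem_gridPts (meshh N r))] with x hx
    rw [dx_ofCoeffs hN hr c hx.1, dy_ofCoeffs hN hr c hx.2]
    simp only [hg, hk]
    ring
  rw [h2]
  refine setIntegral_mono_on hg2 ?_ measurableSet_unitSq fun x hx => ?_
  · refine hκ.integrableOn_mul ae_mem_unitSq hfin ((hkm.pow_const 2).add (hgm.pow_const 2))
      (C := C ^ 2 + C ^ 2) fun x => ?_
    refine (abs_add_le _ _).trans ?_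
    simp only [abs_pow]
    exact add_le_add (pow_le_pow_left₀ (abs_nonneg _) (hkC x) 2)
      (pow_le_pow_left₀ (abs_nonneg _) (hgC x) 2)
  · nlinarith [hκ.one_le x hx, sq_nonneg (k x), sq_nonneg (g x)]

lemma energy_comm (κ u v : ℝ × ℝ → ℝ) : energy κ u v = energy κ v u := by
  simp only [energy, energyOn, mul_comm]

/-- Definiteness comes from `friedrichs`: the energy dominates the integral of the square of a
continuous function that is not identically zero. -/
theorem posDef_stiffness (hN : 0 < N) (hr : 0 < r) (hκ : IsCoefficient κ β) :
    (stiffness N r κ).PosDef := by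
  refine Matrix.PosDef.of_dotProduct_mulVec_pos ?_ fun c hc => ?_
  · ext p q
    simp [stiffness, energy_comm κ (hat q)]
  · rw [star_trivial, ← energy_ofCoeffs hN hr hκ]
    refine lt_of_lt_of_le ?_ (friedrichs hN hr hκ c)
    have hV := ofCoeffs_mem_Vh hN hr c
    have hne : ofCoeffs c ≠ 0 := by
      intro h0
      apply hc
      rw [← coeffs_ofCoeffs hN hr c, h0]
      rfl
    have hcont := continuous_ofCoeffs c
    obtain ⟨x₀, hx₀⟩ := Function.ne_iff.mp hne
    have hall : ∫ x in unitSq, ofCoeffs c x ^ 2 = ∫ x, ofCoeffs c x ^ 2 :=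
      setIntegral_eq_integral_of_forall_compl_eq_zero fun x hx => by rw [hV.2.1 x hx]; simp
    rw [hall]
    refine Continuous.integral_pos_of_hasCompactSupport_nonneg_nonzero (hcont.pow 2) ?_
      (fun x => sq_nonneg _) (x := x₀) (pow_ne_zero 2 hx₀)
    refine HasCompactSupport.of_support_subset_isCompact
      (K := Set.Icc (0 : ℝ) 1 ×ˢ Set.Icc (0 : ℝ) 1) (isCompact_Icc.prod isCompact_Icc) ?_
    intro x hx
    by_contra hx'
    refine hx ?_
    have : x ∉ unitSq := fun h => hx' ⟨Set.Ioo_subset_Icc_self h.1, Set.Ioo_subset_Icc_self h.2⟩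
    simp [hV.2.1 x this]

end Energy

/-! ### Coarse elements -/

section Elements

variable {N r : ℕ}

/-- The open coarse element. -/
def openElem (i : Coarse N) : Set (ℝ × ℝ) :=
  Set.Ioo ((i.1 : ℕ) * meshH N) (((i.1 : ℕ) + 1) * meshH N) ×ˢ
    Set.Ioo ((i.2 : ℕ) * meshH N) (((i.2 : ℕ) + 1) * meshH N)

lemma interior_elem (i : Coarse N) : interior (elem i) = openElem i := by
  rw [elem, cell, interior_prod_eq, interior_Icc, interior_Icc, openElem]

lemma measurableSet_openElem (i : Coarse N) : MeasurableSet (openElem i) :=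
  measurableSet_Ioo.prod measurableSet_Ioo

/-- Element boundaries lie on grid lines, so closed elements can be exchanged for open ones, which
are disjoint and contained in the unit square. -/
lemma openElem_ae_eq_elem (i : Coarse N) : (openElem i : Set (ℝ × ℝ)) =ᵐ[volume] elem i := by
  filter_upwards [ae_notMem_gridPts (meshH N)] with x hx
  refine propext ⟨fun h => ⟨Set.Ioo_subset_Icc_self h.1, Set.Ioo_subset_Icc_self h.2⟩, ?_⟩
  have key : ∀ (n : ℕ) (t : ℝ), t ∉ gridPts (meshH N) →
      t ∈ Set.Icc (n * meshH N) ((n + 1) * meshH N) →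
      t ∈ Set.Ioo (n * meshH N) ((n + 1) * meshH N) := by
    rintro n t ht ⟨h1, h2⟩
    refine ⟨lt_of_le_of_ne h1 fun e => ht ⟨n, ?_⟩, lt_of_le_of_ne h2 fun e => ht ⟨n + 1, ?_⟩⟩
    · simpa using e
    · simpa using e.symm
  exact fun h => ⟨key _ _ hx.1 h.1, key _ _ hx.2 h.2⟩

lemma restrict_elem (i : Coarse N) : volume.restrict (elem i) = volume.restrict (openElem i) :=
  Measure.restrict_congr_set (openElem_ae_eq_elem i).symm

lemma openElem_subset (i : Coarse N) : openElem i ⊆ unitSq := by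
  have hN : 0 < N := Fin.pos i.1
  have hH : 0 < meshH N := by unfold meshH; positivity
  have key : ∀ (n : Fin N) (t : ℝ), t ∈ Set.Ioo ((n : ℕ) * meshH N) (((n : ℕ) + 1) * meshH N) →
      t ∈ Set.Ioo (0 : ℝ) 1 := by
    rintro n t ⟨h1, h2⟩
    refine ⟨lt_of_le_of_lt (by positivity) h1, h2.trans_le ?_⟩
    have h3 : ((n : ℕ) : ℝ) + 1 ≤ N := by exact_mod_cast n.isLt
    have h4 : (N : ℝ) * meshH N = 1 := by unfold meshH; field_simp
    exact (mul_le_mul_of_nonneg_right h3 hH.le).trans h4.le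
  exact fun x hx => ⟨key _ _ hx.1, key _ _ hx.2⟩

lemma eq_of_mem_openElem {i j : Coarse N} {x : ℝ × ℝ} (hi : x ∈ openElem i)
    (hj : x ∈ openElem j) : i = j := by
  have hN : 0 < N := Fin.pos i.1
  have hH : 0 < meshH N := by unfold meshH; positivity
  have key : ∀ (m n : Fin N) (t : ℝ),
      t ∈ Set.Ioo ((m : ℕ) * meshH N) (((m : ℕ) + 1) * meshH N) →
      t ∈ Set.Ioo ((n : ℕ) * meshH N) (((n : ℕ) + 1) * meshH N) → (m : ℕ) ≤ n := by
    rintro m n t ⟨h1, _⟩ ⟨_, h2⟩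
    have h3 := lt_of_mul_lt_mul_right (h1.trans h2) hH.le
    have h4 : (m : ℕ) < (n : ℕ) + 1 := by exact_mod_cast h3
    omega
  exact Prod.ext (Fin.ext (le_antisymm (key _ _ _ hi.1 hj.1) (key _ _ _ hj.1 hi.1)))
    (Fin.ext (le_antisymm (key _ _ _ hi.2 hj.2) (key _ _ _ hj.2 hi.2)))

/-- `x` lies in the open support of the hat function at `p`. -/
def Near (p : Node N r) (x : ℝ × ℝ) : Prop :=
  |x.1 / meshh N r - ((p.1 : ℕ) + 1 : ℕ)| < 1 ∧ |x.2 / meshh N r - ((p.2 : ℕ) + 1 : ℕ)| < 1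

lemma hat_eq_zero {p : Node N r} {x : ℝ × ℝ} (h : ¬ Near p x) : hat p x = 0 := by
  rw [hat_apply]
  rw [Near, not_and_or, not_lt, not_lt] at h
  rcases h with h | h
  · rw [tent_eq_zero h, zero_mul]
  · rw [tent_eq_zero h, mul_zero]

lemma one_lt_abs_of_notMem_gridPts {h t : ℝ} (hh : 0 < h) (ht : t ∉ gridPts h) {m : ℕ}
    (h1 : 1 ≤ |t / h - m|) : 1 < |t / h - m| := by
  refine lt_of_le_of_ne h1 fun e => ?_
  rcases (abs_eq zero_le_one).mp e.symm with e | e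
  · exact div_ne_of_notMem_gridPts hh ht (m + 1) (by push_cast; linarith)
  · exact div_ne_of_notMem_gridPts hh ht (m - 1) (by push_cast; linarith)

lemma grad_hat_eq_zero (hN : 0 < N) (hr : 0 < r) {p : Node N r} {x : ℝ × ℝ}
    (hx : x.1 ∉ gridPts (meshh N r) ∧ x.2 ∉ gridPts (meshh N r)) (h : ¬ Near p x) :
    dx (hat p) x = 0 ∧ dy (hat p) x = 0 := by
  have hh := meshh_pos hN hr
  rw [dx_hat, dy_hat]
  rw [Near, not_and_or, not_lt, not_lt] at h
  rcases h with h | h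
  · rw [tent_eq_zero h, deriv_tent_eq_zero (one_lt_abs_of_notMem_gridPts hh hx.1 h)]
    simp
  · rw [tent_eq_zero h, deriv_tent_eq_zero (one_lt_abs_of_notMem_gridPts hh hx.2 h)]
    simp

/-- A vertex strictly inside a coarse element is, by integrality of its indices, at least one fine
mesh width from the boundary, so the open support of its hat stays inside. -/
lemma Near.mem_openElem (hN : 0 < N) (hr : 0 < r) {p : Node N r} {x : ℝ × ℝ} (h : Near p x)
    {i : Coarse N} (hp : coord p ∈ interior (elem i)) : x ∈ openElem i := by
  have hh := meshh_pos hN hr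
  rw [interior_elem, openElem, meshH_eq hr] at *
  have key : ∀ (a n : ℕ) (t : ℝ), |t / meshh N r - (a + 1 : ℕ)| < 1 →
      ((a : ℝ) + 1) * meshh N r ∈
        Set.Ioo (n * (r * meshh N r)) ((n + 1) * (r * meshh N r)) →
      t ∈ Set.Ioo (n * (r * meshh N r)) ((n + 1) * (r * meshh N r)) := by
    rintro a n t ht ⟨h1, h2⟩
    rw [← mul_assoc] at h1 h2
    have h3 : n * r < a + 1 := by exact_mod_cast lt_of_mul_lt_mul_right h1 hh.le
    have h4 : a + 1 < (n + 1) * r := by exact_mod_cast lt_of_mul_lt_mul_right h2 hh.le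
    have h5 : (n : ℝ) * r ≤ a := by exact_mod_cast (by omega : n * r ≤ a)
    have h6 : (a : ℝ) + 2 ≤ (n + 1) * r := by exact_mod_cast (by omega : a + 2 ≤ (n + 1) * r)
    obtain ⟨h7, h8⟩ := abs_lt.mp ht
    push_cast at h7 h8
    rw [← mul_assoc, ← mul_assoc]
    exact ⟨(lt_div_iff₀ hh).mp (by linarith), (div_lt_iff₀ hh).mp (by linarith)⟩
  exact ⟨key _ _ _ h.1 hp.1, key _ _ _ h.2 hp.2⟩

lemma energyOn_elem_hat (hN : 0 < N) (hr : 0 < r) (κ : ℝ × ℝ → ℝ) {i : Coarse N} {p : Node N r}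
    (hp : coord p ∈ interior (elem i)) :
    energyOn κ (elem i) (hat p) (hat p) = energy κ (hat p) (hat p) := by
  rw [energy, energyOn, energyOn, restrict_elem]
  refine (setIntegral_eq_of_subset_of_ae_sdiff_eq_zero measurableSet_unitSq.nullMeasurableSet
    (openElem_subset i) ?_).symm
  filter_upwards [ae_notMem_gridPts (meshh N r)] with x hx hmem
  obtain ⟨h1, h2⟩ := grad_hat_eq_zero hN hr hx fun hn => hmem.2 (hn.mem_openElem hN hr hp)
  rw [h1, h2]
  simp

/-- Hat functions of vertices that do not belong to a common fine element are orthogonal. -/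
lemma energy_hat_eq_zero (hN : 0 < N) (hr : 0 < r) (κ : ℝ × ℝ → ℝ) {p q : Node N r}
    (hpq : ∀ a b : ℕ, a < N * r → b < N * r →
      ¬ (coord p ∈ cell (meshh N r) a b ∧ coord q ∈ cell (meshh N r) a b)) :
    energy κ (hat p) (hat q) = 0 := by
  have hh := meshh_pos hN hr
  have hzero : ∀ᵐ x, x ∈ unitSq → κ x * (dx (hat p) x * dx (hat q) x +
      dy (hat p) x * dy (hat q) x) = 0 := by
    filter_upwards [ae_notMem_gridPts (meshh N r)] with x hx _
    by_cases hnp : Near p x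
    swap
    · obtain ⟨h1, h2⟩ := grad_hat_eq_zero hN hr hx hnp
      rw [h1, h2]
      simp
    by_cases hnq : Near q x
    swap
    · obtain ⟨h1, h2⟩ := grad_hat_eq_zero hN hr hx hnq
      rw [h1, h2]
      simp
    exfalso
    have key : ∀ (a b : Fin (N * r - 1)) (t : ℝ), |t / meshh N r - ((a : ℕ) + 1 : ℕ)| < 1 →
        |t / meshh N r - ((b : ℕ) + 1 : ℕ)| < 1 → ∃ n < N * r,
          ((a : ℕ) + 1 : ℝ) * meshh N r ∈ Set.Icc (n * meshh N r) ((n + 1) * meshh N r) ∧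
          ((b : ℕ) + 1 : ℝ) * meshh N r ∈ Set.Icc (n * meshh N r) ((n + 1) * meshh N r) := by
      intro a b t ha hb
      obtain ⟨h1, h2⟩ := abs_lt.mp ha
      obtain ⟨h3, h4⟩ := abs_lt.mp hb
      push_cast at h1 h2 h3 h4
      have h5 : (a : ℕ) < b + 2 := by
        have : ((a : ℕ) : ℝ) < (b : ℕ) + 2 := by linarith
        exact_mod_cast this
      have h6 : (b : ℕ) < a + 2 := by
        have : ((b : ℕ) : ℝ) < (a : ℕ) + 2 := by linarith
        exact_mod_cast this
      have ha' := a.isLt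
      have hb' := b.isLt
      -- Overlapping supports force `|a - b| ≤ 1`. Index `a` denotes the grid point `(a + 1) h`, so
      -- the fine interval beginning at the smaller of the two points contains both.
      refine ⟨min (a : ℕ) b + 1, by omega, ?_⟩
      have e1 : ((min (a : ℕ) b + 1 : ℕ) : ℝ) ≤ (a : ℕ) + 1 := by
        exact_mod_cast (by omega : min (a : ℕ) b + 1 ≤ a + 1)
      have e2 : ((min (a : ℕ) b + 1 : ℕ) : ℝ) ≤ (b : ℕ) + 1 := by
        exact_mod_cast (by omega : min (a : ℕ) b + 1 ≤ b + 1)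
      have e3 : (((a : ℕ) : ℝ) + 1) ≤ ((min (a : ℕ) b + 1 : ℕ) : ℝ) + 1 := by
        exact_mod_cast (by omega : (a : ℕ) + 1 ≤ min (a : ℕ) b + 1 + 1)
      have e4 : (((b : ℕ) : ℝ) + 1) ≤ ((min (a : ℕ) b + 1 : ℕ) : ℝ) + 1 := by
        exact_mod_cast (by omega : (b : ℕ) + 1 ≤ min (a : ℕ) b + 1 + 1)
      exact ⟨⟨mul_le_mul_of_nonneg_right e1 hh.le, mul_le_mul_of_nonneg_right e3 hh.le⟩,
        ⟨mul_le_mul_of_nonneg_right e2 hh.le, mul_le_mul_of_nonneg_right e4 hh.le⟩⟩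
    obtain ⟨a, ha, ha1, ha2⟩ := key p.1 q.1 x.1 hnp.1 hnq.1
    obtain ⟨b, hb, hb1, hb2⟩ := key p.2 q.2 x.2 hnp.2 hnq.2
    exact hpq a b ha hb ⟨⟨ha1, hb1⟩, ⟨ha2, hb2⟩⟩
  rw [energy, energyOn, setIntegral_congr_ae measurableSet_unitSq hzero]
  simp

end Elements

/-! ### The local mass forms -/

section Mass

variable {N r : ℕ} {κ : ℝ × ℝ → ℝ} {β : ℝ}

/-- Bounded measurable functions. -/
def bddMeas : Submodule ℝ (ℝ × ℝ → ℝ) where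
  carrier := {u | Measurable u ∧ ∃ C, ∀ x, |u x| ≤ C}
  add_mem' := by
    rintro u v ⟨hu, C, hC⟩ ⟨hv, D, hD⟩
    exact ⟨hu.add hv, C + D, fun x => (abs_add_le _ _).trans (add_le_add (hC x) (hD x))⟩
  zero_mem' := ⟨measurable_const, 0, by simp⟩
  smul_mem' := by
    rintro t u ⟨hu, C, hC⟩
    refine ⟨hu.const_smul t, |t| * C, fun x => ?_⟩
    rw [Pi.smul_apply, smul_eq_mul, abs_mul]
    exact mul_le_mul_of_nonneg_left (hC x) (abs_nonneg t)

lemma ofCoeffs_mem_bddMeas (c : Node N r → ℝ) : ofCoeffs c ∈ bddMeas :=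
  ⟨(continuous_ofCoeffs c).measurable, _, bounded_ofCoeffs c⟩

lemma Vh_le_bddMeas (hN : 0 < N) (hr : 0 < r) : Vh N r ≤ bddMeas := fun v hv => by
  rw [← ofCoeffs_coeffs hN hr hv]
  exact ofCoeffs_mem_bddMeas _

lemma measurableSet_elem (i : Coarse N) : MeasurableSet (elem i) :=
  measurableSet_Icc.prod measurableSet_Icc

lemma VhLoc_le_bddMeas (hN : 0 < N) (hr : 0 < r) (i : Coarse N) : VhLoc N r i ≤ bddMeas := by
  rintro _ ⟨v, hv, rfl⟩
  obtain ⟨hm, C, hC⟩ := Vh_le_bddMeas hN hr hv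
  refine ⟨hm.indicator (measurableSet_elem i), C, fun x => ?_⟩
  change |(elem i).indicator v x| ≤ C
  by_cases hx : x ∈ elem i
  · rw [Set.indicator_of_mem hx]
    exact hC x
  · rw [Set.indicator_of_notMem hx, abs_zero]
    exact (abs_nonneg _).trans (hC x)

lemma ae_elem_mem_unitSq (i : Coarse N) : ∀ᵐ x ∂volume.restrict (elem i), x ∈ unitSq := by
  rw [restrict_elem]
  filter_upwards [ae_restrict_mem (measurableSet_openElem i)] with x hx
  exact openElem_subset i hx

lemma volume_elem_ne_top (i : Coarse N) : volume (elem i) ≠ ⊤ :=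
  (isCompact_Icc.prod isCompact_Icc).measure_ne_top

lemma IsCoefficient.integrableOn_elem (hκ : IsCoefficient κ β) (i : Coarse N) {u v : ℝ × ℝ → ℝ}
    (hu : u ∈ bddMeas) (hv : v ∈ bddMeas) :
    IntegrableOn (fun x => κ x * (u x * v x)) (elem i) := by
  obtain ⟨hu, C, hC⟩ := hu
  obtain ⟨hv, D, hD⟩ := hv
  refine hκ.integrableOn_mul (ae_elem_mem_unitSq i) (volume_elem_ne_top i) (hu.mul hv)
    (C := C * D) fun x => ?_
  rw [abs_mul]
  exact mul_le_mul (hC x) (hD x) (abs_nonneg _) ((abs_nonneg _).trans (hC x))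

lemma massOn_comm (i : Coarse N) (u v : ℝ × ℝ → ℝ) : massOn κ i u v = massOn κ i v u := by
  simp only [massOn, mul_comm (u _)]

lemma massOn_add_left (hκ : IsCoefficient κ β) (i : Coarse N) {u v w : ℝ × ℝ → ℝ}
    (hu : u ∈ bddMeas) (hv : v ∈ bddMeas) (hw : w ∈ bddMeas) :
    massOn κ i (u + v) w = massOn κ i u w + massOn κ i v w := by
  rw [massOn, massOn, massOn, ← mul_add,
    ← integral_add (hκ.integrableOn_elem i hu hw) (hκ.integrableOn_elem i hv hw)]
  congr 2
  ext x
  simp only [Pi.add_apply]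
  ring

lemma massOn_smul_left (i : Coarse N) (t : ℝ) (u w : ℝ × ℝ → ℝ) :
    massOn κ i (t • u) w = t * massOn κ i u w := by
  rw [massOn, massOn, mul_left_comm, ← integral_const_mul t]
  congr 1
  refine integral_congr_ae (Filter.Eventually.of_forall fun x => ?_)
  simp only [Pi.smul_apply, smul_eq_mul]
  ring

lemma massOn_sub_left (hκ : IsCoefficient κ β) (i : Coarse N) {u v w : ℝ × ℝ → ℝ}
    (hu : u ∈ bddMeas) (hv : v ∈ bddMeas) (hw : w ∈ bddMeas) :
    massOn κ i (u - v) w = massOn κ i u w - massOn κ i v w := by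
  have : u - v = u + (-1 : ℝ) • v := by ext x; simp; ring
  rw [this, massOn_add_left hκ i hu (bddMeas.smul_mem _ hv) hw, massOn_smul_left]
  ring

lemma massOn_sum_left (hκ : IsCoefficient κ β) (i : Coarse N) {τ : Type*} (s : Finset τ)
    {u : τ → ℝ × ℝ → ℝ} {w : ℝ × ℝ → ℝ} (hu : ∀ a ∈ s, u a ∈ bddMeas) (hw : w ∈ bddMeas) :
    massOn κ i (∑ a ∈ s, u a) w = ∑ a ∈ s, massOn κ i (u a) w := by
  classical
  induction s using Finset.induction_on with
  | empty => simp [massOn]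
  | insert a s ha ih =>
    rw [Finset.sum_insert ha, Finset.sum_insert ha, massOn_add_left hκ i
      (hu a (Finset.mem_insert_self a s))
      (Submodule.sum_mem _ fun b hb => hu b (Finset.mem_insert_of_mem hb)) hw,
      ih fun b hb => hu b (Finset.mem_insert_of_mem hb)]

lemma massOn_self_nonneg (hκ : IsCoefficient κ β) (i : Coarse N) (u : ℝ × ℝ → ℝ) :
    0 ≤ massOn κ i u u := by
  refine mul_nonneg (sq_nonneg _) (integral_nonneg_of_ae ?_)
  filter_upwards [ae_elem_mem_unitSq i] with x hx
  have := hκ.one_le x hx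
  exact mul_nonneg (by linarith) (mul_self_nonneg _)

/-- Bessel's inequality for the local mass form. -/
lemma massOn_bessel (hκ : IsCoefficient κ β) (i : Coarse N) {τ : Type*} [Fintype τ]
    [DecidableEq τ] {ψ : τ → ℝ × ℝ → ℝ} (hψ : ∀ a, ψ a ∈ bddMeas)
    (horth : ∀ a b, massOn κ i (ψ a) (ψ b) = if a = b then 1 else 0) {u : ℝ × ℝ → ℝ}
    (hu : u ∈ bddMeas) : ∑ a, massOn κ i u (ψ a) ^ 2 ≤ massOn κ i u u := by
  set w : ℝ × ℝ → ℝ := ∑ a, massOn κ i u (ψ a) • ψ a with hw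
  have hwm : w ∈ bddMeas := Submodule.sum_mem _ fun a _ => bddMeas.smul_mem _ (hψ a)
  have hwv : ∀ v ∈ bddMeas, massOn κ i w v = ∑ a, massOn κ i u (ψ a) * massOn κ i (ψ a) v := by
    intro v hv
    rw [hw, massOn_sum_left hκ i _ (fun a _ => bddMeas.smul_mem _ (hψ a)) hv]
    simp only [massOn_smul_left]
  have h0 := massOn_self_nonneg hκ i (u - w)
  have hwu : massOn κ i w u = ∑ a, massOn κ i u (ψ a) ^ 2 := by
    rw [hwv u hu]
    exact Finset.sum_congr rfl fun a _ => by rw [massOn_comm i (ψ a), sq]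
  have hww : massOn κ i w w = ∑ a, massOn κ i u (ψ a) ^ 2 := by
    rw [hwv w hwm]
    refine Finset.sum_congr rfl fun a _ => ?_
    rw [massOn_comm i (ψ a), hwv _ (hψ a), sq]
    simp [horth]
  rw [massOn_sub_left hκ i hu hwm (sub_mem hu hwm), massOn_comm i u, massOn_comm i w (u - w),
    massOn_sub_left hκ i hu hwm hu, massOn_sub_left hκ i hu hwm hwm, massOn_comm i u w, hwu,
    hww] at h0
  linarith

/-- The factors `H⁻²` and `β` of the final estimate originate here: disjoint open elements inside
the unit square, and `κ ≤ β`. -/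
lemma sum_massOn_le (hκ : IsCoefficient κ β) {u : ℝ × ℝ → ℝ} (hu : u ∈ bddMeas) :
    ∑ i : Coarse N, massOn κ i u u ≤ (meshH N)⁻¹ ^ 2 * (β * ∫ x in unitSq, u x ^ 2) := by
  simp only [massOn]
  rw [← Finset.mul_sum]
  refine mul_le_mul_of_nonneg_left ?_ (sq_nonneg _)
  have hint : IntegrableOn (fun x => κ x * (u x * u x)) unitSq := by
    obtain ⟨hm, C, hC⟩ := hu
    refine hκ.integrableOn_mul ae_mem_unitSq (by simp [volume_unitSq]) (hm.mul hm)
      (C := C * C) fun x => ?_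
    rw [abs_mul]
    exact mul_le_mul (hC x) (hC x) (abs_nonneg _) ((abs_nonneg _).trans (hC x))
  have hint2 : IntegrableOn (fun x => β * u x ^ 2) unitSq := by
    obtain ⟨hm, C, hC⟩ := hu
    refine (Measure.integrableOn_of_bounded (M := C ^ 2) (by simp [volume_unitSq])
      (hm.pow_const 2).aestronglyMeasurable (Filter.Eventually.of_forall fun t => ?_)).const_mul β
    rw [Real.norm_eq_abs, abs_pow]
    exact pow_le_pow_left₀ (abs_nonneg _) (hC t) 2
  have h1 : ∑ i : Coarse N, ∫ x in elem i, κ x * (u x * u x) =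
      ∫ x in ⋃ i ∈ (Finset.univ : Finset (Coarse N)), openElem i, κ x * (u x * u x) := by
    rw [integral_biUnion_finset _ (fun i _ => measurableSet_openElem i)]
    · exact Finset.sum_congr rfl fun i _ => by rw [restrict_elem]
    · intro i _ j _ hij
      exact Set.disjoint_left.mpr fun x hi hj => hij (eq_of_mem_openElem hi hj)
    · exact fun i _ => hint.mono_set (openElem_subset i)
  rw [h1, ← integral_const_mul]
  refine (setIntegral_mono_set hint ?_ (Filter.Eventually.of_forall ?_)).trans
    (setIntegral_mono_on hint hint2 measurableSet_unitSq fun x hx => ?_)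
  · filter_upwards [ae_mem_unitSq] with x hx
    have := hκ.one_le x hx
    exact mul_nonneg (by linarith) (mul_self_nonneg _)
  · exact Set.iUnion₂_subset fun i _ => openElem_subset i
  · rw [← sq]
    exact mul_le_mul_of_nonneg_right (hκ.le_beta x hx) (sq_nonneg _)

end Mass

/-! ### Nodal vectors and auxiliary moments -/

section Dual

variable {N r : ℕ} {κ : ℝ × ℝ → ℝ} {β : ℝ}

lemma coeffs_sub (u v : ℝ × ℝ → ℝ) :
    (coeffs (u - v) : Node N r → ℝ) = coeffs u - coeffs v := rfl

lemma coeffs_smul (t : ℝ) (u : ℝ × ℝ → ℝ) :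
    (coeffs (t • u) : Node N r → ℝ) = t • coeffs u := rfl

lemma coeffs_sum {τ : Type*} (s : Finset τ) (u : τ → ℝ × ℝ → ℝ) :
    (coeffs (∑ a ∈ s, u a) : Node N r → ℝ) = ∑ a ∈ s, coeffs (u a) := by
  ext p
  simp [coeffs]

lemma massOn_ofCoeffs (hκ : IsCoefficient κ β) (hN : 0 < N) (hr : 0 < r) (i : Coarse N)
    (c : Node N r → ℝ) {w : ℝ × ℝ → ℝ} (hw : w ∈ bddMeas) :
    massOn κ i (ofCoeffs c) w = ∑ p, c p * massOn κ i (hat p) w := by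
  rw [ofCoeffs, massOn_sum_left hκ i _
    (fun p _ => bddMeas.smul_mem _ (Vh_le_bddMeas hN hr (hat_mem_Vh hN hr p))) hw]
  simp only [massOn_smul_left]

/-! ### The auxiliary projection -/

lemma AuxBasis.psiAux_mem (hN : 0 < N) (hr : 0 < r) (X : AuxBasis N r κ) (i : Coarse N)
    (j : Fin (X.L i)) : X.psiAux i j ∈ bddMeas :=
  VhLoc_le_bddMeas hN hr i (X.psi_mem i _)

lemma AuxBasis.massOn_psiAux (X : AuxBasis N r κ) (i : Coarse N) (j l : Fin (X.L i)) :
    massOn κ i (X.psiAux i j) (X.psiAux i l) = if j = l then 1 else 0 := by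
  rw [AuxBasis.psiAux, AuxBasis.psiAux, X.orthonormal]
  simp [Fin.castLE_inj]

lemma massOn_restr (i : Coarse N) (u w : ℝ × ℝ → ℝ) :
    massOn κ i (restr (elem i) u) w = massOn κ i u w := by
  rw [massOn, massOn]
  congr 1
  refine setIntegral_congr_fun (measurableSet_elem i) fun x hx => ?_
  change κ x * ((elem i).indicator u x * w x) = _
  rw [Set.indicator_of_mem hx]

/-- Pairing the projection with `ψ_l` returns the `l`-th moment by orthonormality, so the kernel is
cut out by linear functionals. -/
lemma AuxBasis.mem_kerProj (hN : 0 < N) (hr : 0 < r) (hκ : IsCoefficient κ β)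
    (X : AuxBasis N r κ) {v : ℝ × ℝ → ℝ} :
    v ∈ X.kerProj ↔ v ∈ Vh N r ∧ ∀ i j, massOn κ i v (X.psiAux i j) = 0 := by
  refine and_congr_right fun _ => forall_congr' fun i => ?_
  simp only [AuxBasis.projLoc, massOn_restr]
  refine ⟨fun h l => ?_, fun h => by simp [h]⟩
  have h1 := massOn_sum_left hκ i Finset.univ
    (u := fun j => massOn κ i v (X.psiAux i j) • X.psiAux i j)
    (fun j _ => bddMeas.smul_mem _ (X.psiAux_mem hN hr i j)) (X.psiAux_mem hN hr i l)
  rw [h] at h1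
  simp only [massOn_smul_left, X.massOn_psiAux, mul_ite, mul_one, mul_zero, Finset.sum_ite_eq',
    Finset.mem_univ, if_true] at h1
  rw [← h1]
  simp [massOn]

namespace DualNodes

variable {X : AuxBasis N r κ} (D : DualNodes X)

/-! ### Dual functions -/

/-- The energy norm of the hat function of a dual node. -/
def nodeNorm (i : Coarse N) (j : Fin (X.L i)) : ℝ :=
  √(energyOn κ (elem i) (hat (D.node i j)) (hat (D.node i j)))

lemma phiHat_eq (i : Coarse N) (j : Fin (X.L i)) :
    D.phiHat i j = (D.nodeNorm i j)⁻¹ • hat (D.node i j) := rfl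

lemma energy_hat_self_pos (hN : 0 < N) (hr : 0 < r) (hκ : IsCoefficient κ β) (p : Node N r) :
    0 < energy κ (hat p) (hat p) := by
  have := (posDef_stiffness hN hr hκ).diag_pos (i := p)
  simpa [stiffness] using this

lemma nodeNorm_pos (hN : 0 < N) (hr : 0 < r) (hκ : IsCoefficient κ β) (i : Coarse N)
    (j : Fin (X.L i)) : 0 < D.nodeNorm i j := by
  rw [nodeNorm, energyOn_elem_hat hN hr κ (D.mem_interior i j)]
  exact Real.sqrt_pos.mpr (energy_hat_self_pos hN hr hκ _)

lemma phiHat_mem (hN : 0 < N) (hr : 0 < r) (i : Coarse N) (j : Fin (X.L i)) :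
    D.phiHat i j ∈ Vh N r := Submodule.smul_mem _ _ (hat_mem_Vh hN hr _)

lemma phiDual_mem (hN : 0 < N) (hr : 0 < r) (i : Coarse N) (j : Fin (X.L i)) :
    D.phiDual i j ∈ Vh N r :=
  Submodule.sum_mem _ fun l _ => Submodule.smul_mem _ _ (D.phiHat_mem hN hr i l)

lemma energy_smul_smul (hN : 0 < N) (hr : 0 < r) (hκ : IsCoefficient κ β) (s t : ℝ)
    {u v : ℝ × ℝ → ℝ} (hu : u ∈ Vh N r) (hv : v ∈ Vh N r) :
    energy κ (s • u) (t • v) = s * t * energy κ u v := by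
  rw [energy_eq_form hN hr hκ (Submodule.smul_mem _ _ hu) (Submodule.smul_mem _ _ hv),
    energy_eq_form hN hr hκ hu hv, coeffs_smul, coeffs_smul, mulVec_smul, dotProduct_smul,
    smul_dotProduct, smul_eq_mul, smul_eq_mul]
  ring

/-- The hat functions of the dual nodes are orthonormal in the energy inner product. -/
lemma energy_phiHat (hN : 0 < N) (hr : 0 < r) (hκ : IsCoefficient κ β)
    (s t : Σ i : Coarse N, Fin (X.L i)) :
    energy κ (D.phiHat s.1 s.2) (D.phiHat t.1 t.2) = if s = t then 1 else 0 := by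
  rw [phiHat_eq, phiHat_eq,
    energy_smul_smul hN hr hκ _ _ (hat_mem_Vh hN hr _) (hat_mem_Vh hN hr _)]
  split_ifs with hst
  · subst hst
    have hpos := energy_hat_self_pos hN hr hκ (D.node s.1 s.2)
    rw [nodeNorm, energyOn_elem_hat hN hr κ (D.mem_interior s.1 s.2), ← mul_inv,
      Real.mul_self_sqrt hpos.le, inv_mul_cancel₀ hpos.ne']
  · rw [energy_hat_eq_zero hN hr κ (D.separated s t hst), mul_zero]

lemma node_injective (hN : 0 < N) (hr : 0 < r) :
    Function.Injective fun s : (Σ i : Coarse N, Fin (X.L i)) => D.node s.1 s.2 := by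
  intro s t hst
  by_contra hne
  simp only at hst
  have hh := meshh_pos hN hr
  -- This is the fine cell with the node as its upper right corner; a repeated node would contradict
  -- separation in it.
  have hmem : coord (D.node s.1 s.2) ∈
      cell (meshh N r) (D.node s.1 s.2).1 (D.node s.1 s.2).2 := by
    refine ⟨⟨?_, le_rfl⟩, ?_, le_rfl⟩ <;>
    · simp only [coord]
      nlinarith
  have h1 := (D.node s.1 s.2).1.isLt
  have h2 := (D.node s.1 s.2).2.isLt
  refine D.separated s t hne _ _ (by omega) (by omega) ⟨hmem, ?_⟩
  rwa [← hst]

/-- Decouples the moments: each element sees only its own dual hats, so the system has diagonal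
blocks `S_i`. -/
lemma massOn_phiHat_of_ne (hN : 0 < N) (hr : 0 < r) {i k : Coarse N} (hik : k ≠ i)
    (j : Fin (X.L k)) (w : ℝ × ℝ → ℝ) : massOn κ i (D.phiHat k j) w = 0 := by
  rw [massOn, restrict_elem]
  have : ∀ x ∈ openElem i, κ x * (D.phiHat k j x * w x) = 0 := by
    intro x hx
    have h0 : hat (D.node k j) x = 0 := hat_eq_zero fun hn =>
      hik (eq_of_mem_openElem (hn.mem_openElem hN hr (D.mem_interior k j)) hx)
    rw [phiHat_eq, Pi.smul_apply, h0]
    simp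
  rw [setIntegral_congr_fun (measurableSet_openElem i) this]
  simp

/-- The auxiliary moments of a combination of the hat functions of the dual nodes. -/
lemma massOn_sum_phiHat (hN : 0 < N) (hr : 0 < r) (hκ : IsCoefficient κ β)
    (c : ∀ k : Coarse N, Fin (X.L k) → ℝ) (i : Coarse N) (l : Fin (X.L i)) :
    massOn κ i (∑ k, ∑ j, c k j • D.phiHat k j) (X.psiAux i l) = (c i ᵥ* D.S i) l := by
  have hV := Vh_le_bddMeas hN hr
  have hψ := X.psiAux_mem hN hr i l
  have hm : ∀ k j, c k j • D.phiHat k j ∈ bddMeas := fun k j =>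
    bddMeas.smul_mem _ (hV (D.phiHat_mem hN hr k j))
  rw [massOn_sum_left hκ i _ (fun k _ => Submodule.sum_mem _ fun j _ => hm k j) hψ,
    Finset.sum_eq_single i]
  · rw [massOn_sum_left hκ i _ (fun j _ => hm i j) hψ]
    simp only [massOn_smul_left, vecMul, dotProduct]
    rfl
  · intro k _ hk
    rw [massOn_sum_left hκ i _ (fun j _ => hm k j) hψ]
    simp only [massOn_smul_left, D.massOn_phiHat_of_ne hN hr hk, mul_zero, Finset.sum_const_zero]
  · simp

lemma isUnit_det_S (i : Coarse N) : IsUnit (D.S i).det := D.nonsingular i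

/-- Combinations of dual functions in terms of hat functions. -/
lemma sum_phiDual (d : ∀ k : Coarse N, Fin (X.L k) → ℝ) :
    ∑ k, ∑ j, d k j • D.phiDual k j = ∑ k, ∑ l, (d k ᵥ* (D.S k)⁻¹) l • D.phiHat k l := by
  refine Finset.sum_congr rfl fun k _ => ?_
  simp only [phiDual, Finset.smul_sum, vecMul, dotProduct, Finset.sum_smul, smul_smul]
  exact Finset.sum_comm

/-- The dual functions are biorthogonal to the auxiliary basis. -/
lemma massOn_sum_phiDual (hN : 0 < N) (hr : 0 < r) (hκ : IsCoefficient κ β)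
    (d : ∀ k : Coarse N, Fin (X.L k) → ℝ) (i : Coarse N) (l : Fin (X.L i)) :
    massOn κ i (∑ k, ∑ j, d k j • D.phiDual k j) (X.psiAux i l) = d i l := by
  rw [sum_phiDual, D.massOn_sum_phiHat hN hr hκ (fun k => d k ᵥ* (D.S k)⁻¹), vecMul_vecMul,
    nonsing_inv_mul _ (D.isUnit_det_S i), vecMul_one]

/-- Orthonormality of the dual hats reduces the Gram matrix of the dual functions to `S⁻¹ S⁻ᵀ`. -/
lemma energy_phiDual (hN : 0 < N) (hr : 0 < r) (hκ : IsCoefficient κ β) (i : Coarse N)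
    (j l : Fin (X.L i)) :
    energy κ (D.phiDual i j) (D.phiDual i l) = ∑ m, (D.S i)⁻¹ j m * (D.S i)⁻¹ l m := by
  have h : ∀ m n, (coeffs (D.phiHat i m) : Node N r → ℝ) ⬝ᵥ
      (stiffness N r κ *ᵥ coeffs (D.phiHat i n)) = if m = n then 1 else 0 := by
    intro m n
    rw [← energy_eq_form hN hr hκ (D.phiHat_mem hN hr i m) (D.phiHat_mem hN hr i n),
      D.energy_phiHat hN hr hκ ⟨i, m⟩ ⟨i, n⟩]
    simp
  have hc : ∀ j, (coeffs (D.phiDual i j) : Node N r → ℝ) =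
      ∑ l, (D.S i)⁻¹ j l • coeffs (D.phiHat i l) := fun j => coeffs_sum _ _
  rw [energy_eq_form hN hr hκ (D.phiDual_mem hN hr i j) (D.phiDual_mem hN hr i l), hc, hc,
    mulVec_sum, sum_dotProduct]
  refine Finset.sum_congr rfl fun m _ => ?_
  rw [dotProduct_sum, Finset.sum_eq_single m]
  · rw [mulVec_smul, dotProduct_smul, smul_dotProduct, h, if_pos rfl, smul_eq_mul, smul_eq_mul]
    ring
  · intro n _ hn
    rw [mulVec_smul, dotProduct_smul, smul_dotProduct, h, if_neg hn.symm, smul_zero, smul_zero]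
  · simp

/-- The left side is the quadratic form `dᵀ G d` of the Gram matrix `G = S⁻¹ S⁻ᵀ`, bounded by the
norm of `G`. -/
lemma sum_sq_vecMul_le (hN : 0 < N) (hr : 0 < r) (hκ : IsCoefficient κ β) (i : Coarse N)
    (d : Fin (X.L i) → ℝ) :
    ∑ l, (d ᵥ* (D.S i)⁻¹) l ^ 2 ≤ D.MLoc i * ∑ j, d j ^ 2 := by
  set G : Matrix (Fin (X.L i)) (Fin (X.L i)) ℝ :=
    Matrix.of fun j l => energy κ (D.phiDual i j) (D.phiDual i l) with hG
  have hGS : G = (D.S i)⁻¹ * ((D.S i)⁻¹)ᵀ := by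
    ext j l
    rw [hG, of_apply, D.energy_phiDual hN hr hκ, mul_apply]
    rfl
  have h1 : ∑ l, (d ᵥ* (D.S i)⁻¹) l ^ 2 = d ⬝ᵥ (G *ᵥ d) := by
    rw [hGS, ← mulVec_mulVec, dotProduct_mulVec, mulVec_transpose]
    simp [dotProduct, sq]
  set v : EuclideanSpace ℝ (Fin (X.L i)) := WithLp.toLp 2 d with hv
  have h2 : d ⬝ᵥ (G *ᵥ d) = inner ℝ v (Matrix.toEuclideanCLM (𝕜 := ℝ) G v) := by
    rw [EuclideanSpace.inner_eq_star_dotProduct, dotProduct_comm]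
    simp [hv]
  have h3 : ∑ j, d j ^ 2 = ‖v‖ ^ 2 := by
    rw [EuclideanSpace.norm_sq_eq]
    simp [hv]
  rw [h1, h2, h3]
  calc inner ℝ v (Matrix.toEuclideanCLM (𝕜 := ℝ) G v)
      ≤ ‖v‖ * ‖Matrix.toEuclideanCLM (𝕜 := ℝ) G v‖ := real_inner_le_norm _ _
    _ ≤ ‖v‖ * (‖Matrix.toEuclideanCLM (𝕜 := ℝ) G‖ * ‖v‖) := by
        gcongr
        exact ContinuousLinearMap.le_opNorm _ _
    _ = D.MLoc i * ‖v‖ ^ 2 := by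
        rw [MLoc]
        ring

lemma MLoc_le (i : Coarse N) : D.MLoc i ≤ D.M :=
  le_ciSup (f := fun i => D.MLoc i) (Set.finite_range _).bddAbove i

/-! ### The kernel of the auxiliary projection -/

/-- The nodal vectors of the functions in the kernel of the auxiliary projection. -/
def kerCoeffs (hN : 0 < N) (hr : 0 < r) (hκ : IsCoefficient κ β) (X : AuxBasis N r κ) :
    Submodule ℝ (Node N r → ℝ) where
  carrier := {c | ∀ i j, massOn κ i (ofCoeffs c) (X.psiAux i j) = 0}
  add_mem' := by
    intro c d hc hd i j
    have hψ := X.psiAux_mem hN hr i j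
    have h1 := hc i j
    have h2 := hd i j
    rw [massOn_ofCoeffs hκ hN hr i _ hψ] at h1 h2 ⊢
    simp only [Pi.add_apply, add_mul, Finset.sum_add_distrib, h1, h2, add_zero]
  zero_mem' := by
    intro i j
    rw [massOn_ofCoeffs hκ hN hr i _ (X.psiAux_mem hN hr i j)]
    simp
  smul_mem' := by
    intro t c hc i j
    have hψ := X.psiAux_mem hN hr i j
    have h1 := hc i j
    rw [massOn_ofCoeffs hκ hN hr i _ hψ] at h1 ⊢
    simp only [Pi.smul_apply, smul_eq_mul, mul_assoc, ← Finset.mul_sum, h1, mul_zero]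

lemma coeffs_mem_kerCoeffs (hN : 0 < N) (hr : 0 < r) (hκ : IsCoefficient κ β)
    {v : ℝ × ℝ → ℝ} (hv : v ∈ Vh N r) :
    coeffs v ∈ kerCoeffs hN hr hκ X ↔ ∀ i j, massOn κ i v (X.psiAux i j) = 0 := by
  change (∀ i j, massOn κ i (ofCoeffs (coeffs v : Node N r → ℝ)) (X.psiAux i j) = 0) ↔ _
  rw [ofCoeffs_coeffs hN hr hv]

lemma phiTilde_mem (hN : 0 < N) (hr : 0 < r) (p : Node N r) : D.phiTilde p ∈ Vh N r :=
  Submodule.sum_mem _ fun i _ => Submodule.sum_mem _ fun j _ =>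
    Submodule.smul_mem _ _ (D.phiDual_mem hN hr i j)

lemma kerVec_mem_kerCoeffs (hN : 0 < N) (hr : 0 < r) (hκ : IsCoefficient κ β) (p : Node N r) :
    D.kerVec p ∈ kerCoeffs hN hr hκ X := by
  have hp : hatNormalized κ p ∈ Vh N r := Submodule.smul_mem _ _ (hat_mem_Vh hN hr p)
  have ht := D.phiTilde_mem hN hr p
  have hV := Vh_le_bddMeas hN hr
  rw [kerVec, coeffs_mem_kerCoeffs hN hr hκ (sub_mem hp ht)]
  intro i j
  rw [massOn_sub_left hκ i (hV hp) (hV ht) (X.psiAux_mem hN hr i j), phiTilde,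
    D.massOn_sum_phiDual hN hr hκ
      (fun i j => massOn κ i (hatNormalized κ p) (X.psiAux i j)), sub_self]

lemma coeffs_hat (hN : 0 < N) (hr : 0 < r) (p q : Node N r) :
    (coeffs (hat p) : Node N r → ℝ) q = if q = p then 1 else 0 := hat_coord hN hr p q

lemma coeffs_phiHat (hN : 0 < N) (hr : 0 < r) {i : Coarse N} {j : Fin (X.L i)} {q : Node N r}
    (hq : ¬ D.IsDual q) : (coeffs (D.phiHat i j) : Node N r → ℝ) q = 0 := by
  rw [phiHat_eq, coeffs_smul, Pi.smul_apply, coeffs_hat hN hr, if_neg, smul_zero]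
  rintro rfl
  exact hq ⟨i, j, rfl⟩

/-- At the vertices that are not dual nodes, the kernel vectors are multiples of unit vectors. -/
lemma kerVec_apply (hN : 0 < N) (hr : 0 < r) (p : Node N r) {q : Node N r} (hq : ¬ D.IsDual q) :
    D.kerVec p q = if q = p then (energyNorm κ (hat p))⁻¹ else 0 := by
  have h0 : (coeffs (D.phiTilde p) : Node N r → ℝ) q = 0 := by
    rw [phiTilde, D.sum_phiDual fun i j => massOn κ i (hatNormalized κ p) (X.psiAux i j)]
    simp only [coeffs_sum, coeffs_smul, Finset.sum_apply, Pi.smul_apply,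
      D.coeffs_phiHat hN hr hq, smul_zero, Finset.sum_const_zero]
  rw [kerVec, coeffs_sub, Pi.sub_apply, h0, sub_zero, hatNormalized, coeffs_smul, Pi.smul_apply,
    coeffs_hat hN hr]
  simp

lemma energyNorm_hat_pos (hN : 0 < N) (hr : 0 < r) (hκ : IsCoefficient κ β) (p : Node N r) :
    0 < energyNorm κ (hat p) := Real.sqrt_pos.mpr (energy_hat_self_pos hN hr hκ p)

/-- Dual functions vanish at non-dual vertices, so evaluation there turns the family into a diagonal
matrix with nonzero entries. -/
lemma linearIndependent_kerVec (hN : 0 < N) (hr : 0 < r) (hκ : IsCoefficient κ β) :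
    LinearIndependent ℝ fun p : {p : Node N r // ¬ D.IsDual p} => D.kerVec p := by
  classical
  rw [Fintype.linearIndependent_iff]
  intro g hg q
  have := congrFun hg (q : Node N r)
  simp only [Finset.sum_apply, Pi.smul_apply, D.kerVec_apply hN hr _ q.2, smul_eq_mul, mul_ite,
    mul_zero, Pi.zero_apply] at this
  rw [Finset.sum_eq_single q] at this
  · rw [if_pos rfl] at this
    exact (mul_eq_zero.mp this).resolve_right
      (inv_ne_zero (energyNorm_hat_pos hN hr hκ q.1).ne')
  · intro p _ hp
    rw [if_neg fun e => hp (Subtype.ext e.symm)]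
  · simp

lemma kerSpan_eq_range : D.kerSpan =
    Submodule.span ℝ (Set.range fun p : {p : Node N r // ¬ D.IsDual p} => D.kerVec p) := by
  rw [kerSpan, Set.image_eq_range]
  rfl

lemma finrank_kerSpan (hN : 0 < N) (hr : 0 < r) (hκ : IsCoefficient κ β) :
    Module.finrank ℝ D.kerSpan = Nat.card {p : Node N r // ¬ D.IsDual p} := by
  classical
  rw [kerSpan_eq_range, finrank_span_eq_card (D.linearIndependent_kerVec hN hr hκ),
    Nat.card_eq_fintype_card]

/-- Match a kernel vector at all non-dual vertices by the vectors `v_p`. The remainder is a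
combination of dual hats with zero moments, hence zero because every `S_i` is invertible. -/
theorem kerCoeffs_eq_kerSpan (hN : 0 < N) (hr : 0 < r) (hκ : IsCoefficient κ β) :
    kerCoeffs hN hr hκ X = D.kerSpan := by
  classical
  refine le_antisymm (fun c hc => ?_) (Submodule.span_le.mpr ?_)
  swap
  · rintro _ ⟨p, -, rfl⟩
    exact D.kerVec_mem_kerCoeffs hN hr hκ p
  -- The factor `energyNorm` undoes the normalization of the hat at `p`.
  set y : Node N r → ℝ := ∑ p : {p : Node N r // ¬ D.IsDual p},
    (c p * energyNorm κ (hat (p : Node N r))) • D.kerVec p with hy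
  have hyspan : y ∈ D.kerSpan := Submodule.sum_mem _ fun p _ =>
    Submodule.smul_mem _ _ (Submodule.subset_span ⟨p, p.2, rfl⟩)
  have hyker : y ∈ kerCoeffs hN hr hκ X := Submodule.sum_mem _ fun p _ =>
    Submodule.smul_mem _ _ (D.kerVec_mem_kerCoeffs hN hr hκ p)
  suffices hz : c - y = 0 by rwa [sub_eq_zero.mp hz]
  set z := c - y with hzdef
  have hzker : z ∈ kerCoeffs hN hr hκ X := sub_mem hc hyker
  have hz0 : ∀ q, ¬ D.IsDual q → z q = 0 := by
    intro q hq
    have hyq : y q = c q := by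
      rw [hy, Finset.sum_apply, Finset.sum_eq_single ⟨q, hq⟩]
      · rw [Pi.smul_apply, D.kerVec_apply hN hr _ hq, if_pos rfl, smul_eq_mul, mul_assoc,
          mul_inv_cancel₀ (energyNorm_hat_pos hN hr hκ q).ne', mul_one]
      · intro p _ hp
        rw [Pi.smul_apply, D.kerVec_apply hN hr _ hq, if_neg, smul_zero]
        exact fun e => hp (Subtype.ext e.symm)
      · simp
    rw [hzdef, Pi.sub_apply, hyq, sub_self]
  set e : ∀ k : Coarse N, Fin (X.L k) → ℝ := fun k j => z (D.node k j) * D.nodeNorm k j with he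
  have hze : ofCoeffs z = ∑ k, ∑ j, e k j • D.phiHat k j := by
    have h1 : ∀ k j, e k j • D.phiHat k j = z (D.node k j) • hat (D.node k j) := by
      intro k j
      rw [phiHat_eq, smul_smul, he, mul_assoc, mul_inv_cancel₀ (D.nodeNorm_pos hN hr hκ k j).ne',
        mul_one]
    simp only [h1]
    rw [ofCoeffs, ← Fintype.sum_sigma' (fun k j => z (D.node k j) • hat (D.node k j))]
    refine (Fintype.sum_of_injective (fun s : (Σ i : Coarse N, Fin (X.L i)) => D.node s.1 s.2)
      (D.node_injective hN hr) _ _ (fun q hq => ?_) fun s => rfl).symm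
    rw [hz0 q, zero_smul]
    rintro ⟨i, j, rfl⟩
    exact hq ⟨⟨i, j⟩, rfl⟩
  have he0 : ∀ i, e i = 0 := by
    intro i
    have h1 : e i ᵥ* D.S i = 0 := by
      ext l
      rw [← D.massOn_sum_phiHat hN hr hκ e i l, ← hze]
      exact hzker i l
    have h2 := congrArg (fun w => w ᵥ* (D.S i)⁻¹) h1
    simpa [vecMul_vecMul, mul_nonsing_inv _ (D.isUnit_det_S i)] using h2
  have : ofCoeffs z = 0 := by
    rw [hze]
    simp [he0]
  rw [← coeffs_ofCoeffs hN hr z, this]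
  rfl

/-! ### The matrix of special basis vectors -/

variable (ord : List (Node N r))

lemma K_mulVec (x : Fin (D.basisVecs ord).length → ℝ) :
    D.K ord *ᵥ x = ∑ c, x c • (D.basisVecs ord).get c := by
  ext p
  simp [K, mulVec, dotProduct, mul_comm]

lemma span_range_get (hN : 0 < N) (hr : 0 < r) (hκ : IsCoefficient κ β) (hord : ∀ p, p ∈ ord) :
    Submodule.span ℝ (Set.range (D.basisVecs ord).get) = D.kerSpan := by
  rw [← D.listSpan_basisVecs ord hr (posDef_stiffness hN hr hκ) hord, listSpan]
  congr 1
  ext x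
  simp [List.mem_iff_get]

lemma exists_K_mulVec (hN : 0 < N) (hr : 0 < r) (hκ : IsCoefficient κ β)
    (hord : ∀ p, p ∈ ord) {w : Node N r → ℝ} :
    w ∈ kerCoeffs hN hr hκ X ↔ ∃ x, D.K ord *ᵥ x = w := by
  rw [D.kerCoeffs_eq_kerSpan hN hr hκ, ← D.span_range_get ord hN hr hκ hord,
    Submodule.mem_span_range_iff_exists_fun]
  simp only [K_mulVec]

/-- The columns are no more numerous than the dimension of their span, hence independent. -/
lemma K_injective (hN : 0 < N) (hr : 0 < r) (hκ : IsCoefficient κ β) (hnd : ord.Nodup)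
    (hord : ∀ p, p ∈ ord) : Function.Injective (D.K ord).mulVec := by
  have hli : LinearIndependent ℝ (D.basisVecs ord).get := by
    rw [linearIndependent_iff_card_le_finrank_span, Set.finrank,
      D.span_range_get ord hN hr hκ hord, D.finrank_kerSpan hN hr hκ, Fintype.card_fin]
    exact D.length_basisVecs_le ord hr hnd hord
  rw [Matrix.mulVec_injective_iff]
  exact hli

lemma posDef_KAK (hN : 0 < N) (hr : 0 < r) (hκ : IsCoefficient κ β) (hnd : ord.Nodup)
    (hord : ∀ p, p ∈ ord) : (D.KAK ord).PosDef := by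
  have := (posDef_stiffness hN hr hκ).conjTranspose_mul_mul_same
    (D.K_injective ord hN hr hκ hnd hord)
  rwa [conjTranspose_eq_transpose_of_trivial] at this

lemma basisVecs_length_pos (hN : 0 < N) (hr : 0 < r) (hκ : IsCoefficient κ β)
    (hord : ∀ p, p ∈ ord) (hker : ∃ p, ¬ D.IsDual p) : 0 < (D.basisVecs ord).length := by
  classical
  have h1 : Module.finrank ℝ D.kerSpan ≤ (D.basisVecs ord).length := by
    rw [← D.span_range_get ord hN hr hκ hord]
    exact (finrank_range_le_card _).trans (by simp)
  rw [D.finrank_kerSpan hN hr hκ] at h1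
  obtain ⟨p, hp⟩ := hker
  have : Nonempty {p : Node N r // ¬ D.IsDual p} := ⟨⟨p, hp⟩⟩
  exact Nat.card_pos.trans_le h1

end DualNodes

end Dual

/-! ### Stability of Galerkin solutions -/

section Stability

lemma integral_mul_le_L2 {α : Type*} [MeasurableSpace α] {μ : Measure α} {f u : α → ℝ}
    (hf : MemLp f 2 μ) (hu : MemLp u 2 μ) :
    ∫ x, f x * u x ∂μ ≤ (eLpNorm f 2 μ).toReal * √(∫ x, u x ^ 2 ∂μ) := by
  have hinner : ∀ {g v : α → ℝ} (hg : MemLp g 2 μ) (hv : MemLp v 2 μ),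
      inner ℝ (hg.toLp g) (hv.toLp v) = ∫ x, g x * v x ∂μ := by
    intro g v hg hv
    rw [L2.inner_def]
    refine integral_congr_ae ?_
    filter_upwards [hg.coeFn_toLp, hv.coeFn_toLp] with x h1 h2
    rw [h1, h2]
    simp [mul_comm]
  have h1 : ‖hu.toLp u‖ = √(∫ x, u x ^ 2 ∂μ) := by
    have : ‖hu.toLp u‖ ^ 2 = ∫ x, u x ^ 2 ∂μ := by
      rw [← real_inner_self_eq_norm_sq, hinner hu hu]
      simp only [sq]
    rw [← this, Real.sqrt_sq (norm_nonneg _)]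
  rw [← hinner hf hu, ← h1, ← Lp.norm_toLp f hf]
  exact real_inner_le_norm _ _

variable {N r : ℕ} {κ : ℝ × ℝ → ℝ} {β : ℝ}

/-- Galerkin solutions are bounded in `L²` by the data. -/
lemma integral_sq_le_of_isGalerkin (hN : 0 < N) (hr : 0 < r) (hκ : IsCoefficient κ β)
    {f : ℝ × ℝ → ℝ} (hf : MemLp f 2 (volume.restrict unitSq)) {V : Set (ℝ × ℝ → ℝ)}
    (hV : V ⊆ Vh N r) {u : ℝ × ℝ → ℝ} (hu : IsGalerkin κ f V u) :
    ∫ x in unitSq, u x ^ 2 ≤ (eLpNorm f 2 (volume.restrict unitSq)).toReal ^ 2 := by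
  have huV := hV hu.1
  obtain ⟨hm, C, hC⟩ := Vh_le_bddMeas hN hr huV
  have : IsFiniteMeasure (volume.restrict unitSq) := ⟨by simp [volume_unitSq]⟩
  have hu2 : MemLp u 2 (volume.restrict unitSq) :=
    MemLp.of_bound hm.aestronglyMeasurable C (Filter.Eventually.of_forall hC)
  have h1 := integral_mul_le_L2 hf hu2
  rw [← hu.2 u hu.1] at h1
  have h2 := friedrichs hN hr hκ (coeffs u : Node N r → ℝ)
  rw [ofCoeffs_coeffs hN hr huV] at h2
  set n2 := ∫ x in unitSq, u x ^ 2 with hn2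
  have h0 : 0 ≤ n2 := integral_nonneg fun x => sq_nonneg _
  set F := (eLpNorm f 2 (volume.restrict unitSq)).toReal with hF
  have hF0 : 0 ≤ F := ENNReal.toReal_nonneg
  -- Testing the Galerkin equation with `u` gives `‖u‖² ≤ a(u, u) = ∫ f u ≤ ‖f‖ ‖u‖`; division by
  -- `‖u‖` needs the zero case apart.
  have h3 : √n2 * √n2 ≤ F * √n2 := by
    rw [Real.mul_self_sqrt h0]
    exact h2.trans h1
  have h4 : √n2 ≤ F := by
    rcases (Real.sqrt_nonneg n2).eq_or_lt with e | hpos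
    · rw [← e]
      exact hF0
    · exact le_of_mul_le_mul_right h3 hpos
  calc n2 = √n2 ^ 2 := (Real.sq_sqrt h0).symm
    _ ≤ F ^ 2 := pow_le_pow_left₀ (Real.sqrt_nonneg _) h4 2

end Stability

/-! ### Iterative correctors -/

namespace DualNodes

variable {N r : ℕ} {κ : ℝ × ℝ → ℝ} {β : ℝ} {X : AuxBasis N r κ} (D : DualNodes X)
  (ord : List (Node N r))

lemma form_KAK (x y : Fin (D.basisVecs ord).length → ℝ) :
    x ⬝ᵥ (D.KAK ord *ᵥ y) =
      (D.K ord *ᵥ x) ⬝ᵥ (stiffness N r κ *ᵥ (D.K ord *ᵥ y)) := by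
  rw [KAK, ← mulVec_mulVec, ← mulVec_mulVec, dotProduct_mulVec, vecMul_transpose]

/-- The reduction factor of `k` conjugate gradient steps. -/
def cgFactor (k : ℕ) : ℝ := 2 * D.q ord ^ k / (1 + D.q ord ^ (2 * k))

/-- Read off from the convergence estimate for one nonzero vector, without inspecting the condition
number. -/
lemma cgFactor_nonneg (hN : 0 < N) (hr : 0 < r) (hκ : IsCoefficient κ β) (hnd : ord.Nodup)
    (hord : ∀ p, p ∈ ord) (hker : ∃ p, ¬ D.IsDual p) (k : ℕ) : 0 ≤ D.cgFactor ord k := by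
  have : Nonempty (Fin (D.basisVecs ord).length) :=
    ⟨⟨0, D.basisVecs_length_pos ord hN hr hκ hord hker⟩⟩
  have hB := D.posDef_KAK ord hN hr hκ hnd hord
  set x : Fin (D.basisVecs ord).length → ℝ := fun _ => 1 with hx
  have hx0 : x ≠ 0 := fun h => one_ne_zero (congrFun h (Classical.arbitrary _))
  have hpos : 0 < √(x ⬝ᵥ (D.KAK ord *ᵥ x)) := Real.sqrt_pos.mpr
    (lt_of_le_of_ne (form_nonneg hB x) fun h => hx0 (form_self_eq_zero hB h.symm))
  have := cg_error_bound (x := x) hB rfl k (q := D.q ord) rfl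
  exact nonneg_of_mul_nonneg_left ((Real.sqrt_nonneg _).trans this) hpos

lemma coeffs_corrector (hN : 0 < N) (hr : 0 < r) (k : ℕ) (i : Coarse N) (j : Fin (X.L i)) :
    (coeffs (D.corrector ord k i j) : Node N r → ℝ) = D.K ord *ᵥ cg (D.KAK ord)
      ((D.K ord)ᵀ *ᵥ (stiffness N r κ *ᵥ coeffs (D.phiHat i j))) k :=
  coeffs_ofCoeffs hN hr _

/-- The exact corrector and the distance of the iterative corrector from it. -/
lemma exists_corrector (hN : 0 < N) (hr : 0 < r) (hκ : IsCoefficient κ β) (hnd : ord.Nodup)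
    (hord : ∀ p, p ∈ ord) (hker : ∃ p, ¬ D.IsDual p) (k : ℕ)
    (s : Σ i : Coarse N, Fin (X.L i)) :
    ∃ y ∈ kerCoeffs hN hr hκ X,
      (∀ w ∈ kerCoeffs hN hr hκ X,
        (coeffs (D.phiHat s.1 s.2) - y) ⬝ᵥ (stiffness N r κ *ᵥ w) = 0) ∧
      √((y - coeffs (D.corrector ord k s.1 s.2)) ⬝ᵥ
        (stiffness N r κ *ᵥ (y - coeffs (D.corrector ord k s.1 s.2)))) ≤ D.cgFactor ord k := by
  have : Nonempty (Fin (D.basisVecs ord).length) :=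
    ⟨⟨0, D.basisVecs_length_pos ord hN hr hκ hord hker⟩⟩
  have hA := posDef_stiffness hN hr hκ
  have hB := D.posDef_KAK ord hN hr hκ hnd hord
  set φ : Node N r → ℝ := coeffs (D.phiHat s.1 s.2) with hφ
  set b := (D.K ord)ᵀ *ᵥ (stiffness N r κ *ᵥ φ) with hb
  set x := (D.KAK ord)⁻¹ *ᵥ b with hxdef
  have hx : D.KAK ord *ᵥ x = b := by
    rw [hxdef, mulVec_mulVec, mul_nonsing_inv _ ((isUnit_iff_isUnit_det _).mp hB.isUnit),
      one_mulVec]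
  -- The normal equations tested against all `z` say that `K x` is the `a`-orthogonal projection of
  -- `φ` onto the kernel.
  have horth : ∀ w ∈ kerCoeffs hN hr hκ X,
      (φ - D.K ord *ᵥ x) ⬝ᵥ (stiffness N r κ *ᵥ w) = 0 := by
    intro w hw
    obtain ⟨z, rfl⟩ := (D.exists_K_mulVec ord hN hr hκ hord).mp hw
    have h1 : z ⬝ᵥ (D.KAK ord *ᵥ x) = z ⬝ᵥ b := by rw [hx]
    rw [form_KAK, hb, dotProduct_mulVec z, vecMul_transpose] at h1
    rw [sub_dotProduct, dotProduct_mulVec_symm hA.isHermitian φ,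
      dotProduct_mulVec_symm hA.isHermitian (D.K ord *ᵥ x), h1, sub_self]
  refine ⟨D.K ord *ᵥ x, (D.exists_K_mulVec ord hN hr hκ hord).mpr ⟨x, rfl⟩, horth, ?_⟩
  have hcg := cg_error_bound hB hx k (q := D.q ord) rfl
  rw [form_KAK, form_KAK, mulVec_sub] at hcg
  rw [D.coeffs_corrector ord hN hr k s.1 s.2]
  refine hcg.trans ?_
  -- An orthogonal projection does not increase the energy, and `φ` has energy one.
  have hle : √((D.K ord *ᵥ x) ⬝ᵥ (stiffness N r κ *ᵥ (D.K ord *ᵥ x))) ≤ 1 := by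
    rw [Real.sqrt_le_iff, one_pow]
    refine ⟨zero_le_one, ?_⟩
    have h1 := horth _ ((D.exists_K_mulVec ord hN hr hκ hord).mpr ⟨x, rfl⟩)
    rw [dotProduct_mulVec_symm hA.isHermitian] at h1
    have h2 := form_le_form_add hA h1
    rw [add_sub_cancel] at h2
    refine h2.trans ?_
    rw [hφ, ← energy_eq_form hN hr hκ (D.phiHat_mem hN hr s.1 s.2) (D.phiHat_mem hN hr s.1 s.2),
      D.energy_phiHat hN hr hκ, if_pos rfl]
  exact mul_le_of_le_one_right (D.cgFactor_nonneg ord hN hr hκ hnd hord hker k) hle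

lemma VmsLocal_le (hN : 0 < N) (hr : 0 < r) (k : ℕ) : D.VmsLocal ord k ≤ Vh N r := by
  refine Submodule.span_le.mpr ?_
  rintro _ ⟨s, rfl⟩
  exact sub_mem (D.phiHat_mem hN hr s.1 s.2) (ofCoeffs_mem_Vh hN hr _)

/-- The coordinates of the ideal solution with respect to the ideal multiscale basis. -/
def msCoord (D : DualNodes X) (u : ℝ × ℝ → ℝ) (s : Σ i : Coarse N, Fin (X.L i)) : ℝ :=
  ((fun j => massOn κ s.1 u (X.psiAux s.1 j)) ᵥ* (D.S s.1)⁻¹) s.2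

/-- In terms of dual functions the sum has the moments of `u` as coefficients, so by biorthogonality
it has the same moments as `u`. -/
lemma sub_sum_msCoord_mem (hN : 0 < N) (hr : 0 < r) (hκ : IsCoefficient κ β) {u : ℝ × ℝ → ℝ}
    (hu : u ∈ Vh N r) :
    coeffs u - ∑ s, D.msCoord u s • coeffs (D.phiHat s.1 s.2) ∈ kerCoeffs hN hr hκ X := by
  set d : ∀ k : Coarse N, Fin (X.L k) → ℝ := fun i j => massOn κ i u (X.psiAux i j) with hd
  have hg : ∑ k, ∑ j, d k j • D.phiDual k j ∈ Vh N r :=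
    Submodule.sum_mem _ fun k _ => Submodule.sum_mem _ fun j _ =>
      Submodule.smul_mem _ _ (D.phiDual_mem hN hr k j)
  have h1 : (∑ s, D.msCoord u s • coeffs (D.phiHat s.1 s.2) : Node N r → ℝ) =
      coeffs (∑ k, ∑ j, d k j • D.phiDual k j) := by
    rw [D.sum_phiDual d, ← Finset.univ_sigma_univ, Finset.sum_sigma, coeffs_sum]
    refine Finset.sum_congr rfl fun k _ => ?_
    rw [coeffs_sum]
    rfl
  have hV := Vh_le_bddMeas hN hr
  rw [h1, ← coeffs_sub, coeffs_mem_kerCoeffs hN hr hκ (sub_mem hu hg)]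
  intro i l
  rw [massOn_sub_left hκ i (hV hu) (hV hg) (X.psiAux_mem hN hr i l),
    D.massOn_sum_phiDual hN hr hκ d, sub_self]

lemma sum_sq_msCoord_le (hN : 0 < N) (hr : 0 < r) (hκ : IsCoefficient κ β) {u : ℝ × ℝ → ℝ}
    (hu : u ∈ Vh N r) :
    ∑ s, D.msCoord u s ^ 2 ≤ D.M * ((meshH N)⁻¹ ^ 2 * (β * ∫ x in unitSq, u x ^ 2)) := by
  have hub := Vh_le_bddMeas hN hr hu
  have hM : 0 ≤ D.M :=
    (norm_nonneg _).trans (D.MLoc_le (⟨0, hN⟩, ⟨0, hN⟩))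
  calc ∑ s, D.msCoord u s ^ 2
      = ∑ i, ∑ l, ((fun j => massOn κ i u (X.psiAux i j)) ᵥ* (D.S i)⁻¹) l ^ 2 := by
        rw [← Finset.univ_sigma_univ, Finset.sum_sigma]
        rfl
    _ ≤ ∑ i : Coarse N, D.M * massOn κ i u u := by
        refine Finset.sum_le_sum fun i _ => (D.sum_sq_vecMul_le hN hr hκ i _).trans ?_
        exact mul_le_mul (D.MLoc_le i)
          (massOn_bessel hκ i (X.psiAux_mem hN hr i) (X.massOn_psiAux i) hub)
          (Finset.sum_nonneg fun j _ => sq_nonneg _) hM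
    _ ≤ _ := by
        rw [← Finset.mul_sum]
        exact mul_le_mul_of_nonneg_left (sum_massOn_le hκ hub) hM

/-- An element of the ideal multiscale space is the combination of corrected hat functions given by
its coordinates. -/
lemma coeffs_eq_of_mem_Vms (hN : 0 < N) (hr : 0 < r) (hκ : IsCoefficient κ β)
    {u : ℝ × ℝ → ℝ} (hu : u ∈ X.Vms)
    {y : (Σ i : Coarse N, Fin (X.L i)) → Node N r → ℝ}
    (hy : ∀ s, y s ∈ kerCoeffs hN hr hκ X)
    (horth : ∀ s, ∀ w ∈ kerCoeffs hN hr hκ X,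
      (coeffs (D.phiHat s.1 s.2) - y s) ⬝ᵥ (stiffness N r κ *ᵥ w) = 0) :
    coeffs u = ∑ s, D.msCoord u s • (coeffs (D.phiHat s.1 s.2) - y s) := by
  rw [← sub_eq_zero]
  set e := coeffs u - ∑ s, D.msCoord u s • (coeffs (D.phiHat s.1 s.2) - y s) with he
  -- The difference `e` lies in the kernel, and both of its parts are `a`-orthogonal to the kernel;
  -- so its energy is zero.
  have hmem : e ∈ kerCoeffs hN hr hκ X := by
    have h1 := add_mem (D.sub_sum_msCoord_mem hN hr hκ hu.1)
      (Submodule.sum_mem _ fun s (_ : s ∈ Finset.univ) =>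
        (kerCoeffs hN hr hκ X).smul_mem (D.msCoord u s) (hy s))
    convert h1 using 1
    rw [he]
    simp only [smul_sub, Finset.sum_sub_distrib]
    abel
  refine form_self_eq_zero (posDef_stiffness hN hr hκ) ?_
  have hu0 : ∀ w ∈ kerCoeffs hN hr hκ X, coeffs u ⬝ᵥ (stiffness N r κ *ᵥ w) = 0 := by
    intro w hw
    have := hu.2 (ofCoeffs w) ((X.mem_kerProj hN hr hκ).mpr ⟨ofCoeffs_mem_Vh hN hr w, hw⟩)
    rwa [energy_eq_form hN hr hκ hu.1 (ofCoeffs_mem_Vh hN hr w), coeffs_ofCoeffs hN hr] at this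
  nth_rewrite 1 [he]
  rw [sub_dotProduct, hu0 _ hmem, sum_dotProduct]
  simp only [smul_dotProduct, horth _ _ hmem, smul_zero, Finset.sum_const_zero, sub_zero]

end DualNodes

/-- Galerkin solutions on a subspace are best approximations in the energy norm. -/
lemma energyNorm_sub_le_of_isGalerkin {N r : ℕ} {κ : ℝ × ℝ → ℝ} {β : ℝ} (hN : 0 < N) (hr : 0 < r)
    (hκ : IsCoefficient κ β) {f uh u w : ℝ × ℝ → ℝ} {V : Submodule ℝ (ℝ × ℝ → ℝ)}
    (hV : V ≤ Vh N r) (huh : IsGalerkin κ f (Vh N r) uh) (hu : IsGalerkin κ f V u) (hw : w ∈ V) :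
    energyNorm κ (uh - u) ≤ energyNorm κ (uh - w) := by
  have huV : u ∈ V := hu.1
  have huhV : uh ∈ Vh N r := huh.1
  have hd : u - w ∈ V := sub_mem huV hw
  have hA := posDef_stiffness (N := N) (r := r) hN hr hκ
  have h1 := huh.2 _ (hV hd)
  have h2 := hu.2 _ hd
  rw [← h2, energy_eq_form hN hr hκ huhV (hV hd), energy_eq_form hN hr hκ (hV huV) (hV hd),
    ← sub_eq_zero, ← sub_dotProduct, ← coeffs_sub] at h1
  rw [energyNorm, energyNorm,
    energy_eq_form hN hr hκ (sub_mem huhV (hV huV)) (sub_mem huhV (hV huV)),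
    energy_eq_form hN hr hκ (sub_mem huhV (hV hw)) (sub_mem huhV (hV hw))]
  refine Real.sqrt_le_sqrt ?_
  have h3 := form_le_form_add hA h1
  have h4 : (coeffs (uh - u) + coeffs (u - w) : Node N r → ℝ) = coeffs (uh - w) := by
    simp only [coeffs_sub]
    abel
  rwa [h4] at h3

end SpectralLOD

end

/-! ### The error estimate -/

theorem theorem6p2 (N r : ℕ) (hN : 0 < N) (hr : 0 < r)
    (κ : ℝ × ℝ → ℝ) (β : ℝ) (hκ_meas : Measurable κ)
    (hκ_pc : (κ '' SpectralLOD.unitSq).Finite)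
    (hκ_min : IsLeast (κ '' SpectralLOD.unitSq) 1)
    (hκ_max : IsGreatest (κ '' SpectralLOD.unitSq) β)
    (f : ℝ × ℝ → ℝ) (hf : MemLp f 2 (volume.restrict SpectralLOD.unitSq))
    (X : SpectralLOD.AuxBasis N r κ) (D : SpectralLOD.DualNodes X)
    (ord : List (SpectralLOD.Node N r)) (hord_nodup : ord.Nodup) (hord_mem : ∀ p, p ∈ ord)
    (hker : ∃ p, ¬ D.IsDual p) (k : ℕ)
    (uh ums umsk : ℝ × ℝ → ℝ)
    (huh : SpectralLOD.IsGalerkin κ f (SpectralLOD.Vh N r) uh)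
    (hums : SpectralLOD.IsGalerkin κ f X.Vms ums)
    (humsk : SpectralLOD.IsGalerkin κ f (D.VmsLocal ord k) umsk) :
    SpectralLOD.energyNorm κ (uh - umsk) ≤ SpectralLOD.energyNorm κ (uh - ums) +
      2 * D.q ord ^ k / (1 + D.q ord ^ (2 * k)) * √(X.Ltot : ℝ) * √D.M *
        (SpectralLOD.meshH N)⁻¹ * √β *
        (eLpNorm f 2 (volume.restrict SpectralLOD.unitSq)).toReal := by
  open SpectralLOD SpectralLOD.DualNodes in
  have hκ : IsCoefficient κ β :=
    ⟨hκ_meas, fun x hx => hκ_min.2 ⟨x, hx, rfl⟩, fun x hx => hκ_max.2 ⟨x, hx, rfl⟩⟩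
  have hA := posDef_stiffness (N := N) (r := r) hN hr hκ
  choose y hy horth herr using fun s =>
    D.exists_corrector ord hN hr hκ hord_nodup hord_mem hker k s
  set ε := D.cgFactor ord k with hε
  have hε0 : 0 ≤ ε := D.cgFactor_nonneg ord hN hr hκ hord_nodup hord_mem hker k
  set F := (eLpNorm f 2 (volume.restrict unitSq)).toReal with hF
  have hF0 : 0 ≤ F := ENNReal.toReal_nonneg
  have humsV : ums ∈ Vh N r := hums.1.1
  have huhV : uh ∈ Vh N r := huh.1
  set c := D.msCoord ums with hc
  -- The competitor keeps the coordinates of the ideal solution and replaces exact correctors by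
  -- iterative ones.
  set w : ℝ × ℝ → ℝ := ∑ s, c s • (D.phiHat s.1 s.2 - D.corrector ord k s.1 s.2) with hw
  have hwV : w ∈ D.VmsLocal ord k := Submodule.sum_mem _ fun s _ =>
    Submodule.smul_mem _ _ (Submodule.subset_span ⟨s, rfl⟩)
  have hwVh := D.VmsLocal_le ord hN hr k hwV
  refine (energyNorm_sub_le_of_isGalerkin hN hr hκ (D.VmsLocal_le ord hN hr k) huh humsk
    hwV).trans ?_
  have hsplit : (coeffs (uh - w) : Node N r → ℝ) = coeffs (uh - ums) +
      ∑ s, (-c s) • (y s - coeffs (D.corrector ord k s.1 s.2)) := by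
    have h1 := D.coeffs_eq_of_mem_Vms hN hr hκ hums.1 hy horth
    rw [coeffs_sub, coeffs_sub, h1, hw, coeffs_sum]
    simp only [coeffs_smul, coeffs_sub, smul_sub, Finset.sum_sub_distrib, neg_smul,
      Finset.sum_neg_distrib]
    abel
  rw [energyNorm, energyNorm,
    energy_eq_form hN hr hκ (sub_mem huhV hwVh) (sub_mem huhV hwVh),
    energy_eq_form hN hr hκ (sub_mem huhV humsV) (sub_mem huhV humsV), hsplit]
  refine (sqrt_form_add_le hA _ _).trans (add_le_add_right ?_ _)
  refine (sqrt_form_sum_le hA _ _).trans ?_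
  have hsum : ∑ s, √(((-c s) • (y s - coeffs (D.corrector ord k s.1 s.2))) ⬝ᵥ
      (stiffness N r κ *ᵥ ((-c s) • (y s - coeffs (D.corrector ord k s.1 s.2))))) ≤
      ε * ∑ s, |c s| := by
    rw [Finset.mul_sum]
    refine Finset.sum_le_sum fun s _ => ?_
    rw [sqrt_form_smul, abs_neg, mul_comm ε]
    exact mul_le_mul_of_nonneg_left (herr s) (abs_nonneg _)
  refine hsum.trans ?_
  have hH : 0 ≤ (meshH N)⁻¹ := by unfold meshH; positivity
  have hβ : 0 ≤ β := by
    obtain ⟨x, hx, -⟩ := hκ_min.1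
    linarith [hκ.one_le x hx, hκ.le_beta x hx]
  have hM : 0 ≤ D.M := (norm_nonneg _).trans (D.MLoc_le (⟨0, hN⟩, ⟨0, hN⟩))
  have hc2 : ∑ s, c s ^ 2 ≤ D.M * ((meshH N)⁻¹ ^ 2 * (β * F ^ 2)) := by
    refine (D.sum_sq_msCoord_le hN hr hκ humsV).trans ?_
    have := integral_sq_le_of_isGalerkin hN hr hκ hf (fun v hv => hv.1) hums
    gcongr
  have hcard : (Fintype.card (Σ i : Coarse N, Fin (X.L i)) : ℝ) = X.Ltot := by
    simp [AuxBasis.Ltot]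
  have hc1 : ∑ s, |c s| ≤ √(X.Ltot : ℝ) * (√D.M * ((meshH N)⁻¹ * (√β * F))) := by
    -- Cauchy–Schwarz over the `L` coordinates, the source of `√L`.
    have h1 : (∑ s, |c s|) ^ 2 ≤ (X.Ltot : ℝ) * ∑ s, c s ^ 2 := by
      have := sq_sum_le_card_mul_sum_sq (s := Finset.univ) (f := fun s => |c s|)
      rw [Finset.card_univ, hcard] at this
      simpa only [sq_abs] using this
    refine abs_le_of_sq_le_sq' ?_ (by positivity) |>.2
    refine h1.trans ((mul_le_mul_of_nonneg_left hc2 (Nat.cast_nonneg _)).trans (le_of_eq ?_))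
    simp only [mul_pow, Real.sq_sqrt hM, Real.sq_sqrt hβ, Real.sq_sqrt (Nat.cast_nonneg X.Ltot)]
  refine (mul_le_mul_of_nonneg_left hc1 hε0).trans (le_of_eq ?_)
  rw [hε, cgFactor]
  ring
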